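/- Let $k$ be a commutative artinian ring and $A$ an Artin $k$-algebra, that is, a $k$-algebra that is finitely generated as a $k$-module. Let $\operatorname{mod} A$ be the category of left $A$-modules of finite length. An \emph{ideal} $\mathcal{I}$ of $\operatorname{mod} A$ consists of a subgroup $\mathcal{I}(X,Y)\subseteq \operatorname{Hom}_A(X,Y)$ for all $X,Y\in\operatorname{mod} A$ such that $\beta f\alpha\in\mathcal{I}$ whenever $f\in\mathcal{I}$ and $\alpha,\beta$ are morphisms for which the composite is defined. The product $\mathcal{I}\mathcal{J}$ of two ideals consists of all finite sums of composites $gf$ with $g\in\mathcal{I}$ and $f\in\mathcal{J}$; $\mathcal{J}^n$ denotes the $n$-fold product, and $\mathcal{J}^\omega=\bigcap_{n\ge 1}\mathcal{J}^n$. A functor $F\colon \operatorname{mod} A\to\mathrm{Ab}$ is \emph{finitely presented} if $F\cong\operatorname{coker}\operatorname{Hom}_A(f,-)$ for some morphism $f$ in $\operatorname{mod} A$; these functors form an abelian category $\mathrm{fp}(\operatorname{mod} A,\mathrm{Ab})$. An ideal $\mathcal{I}$ is \emph{fp-idempotent} if $\{F\in\mathrm{fp}(\operatorname{mod} A,\mathrm{Ab})\mid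 F(f)=0\text{ for all }f\in\mathcal{I}\}$ is a Serre subcategory of $\mathrm{fp}(\operatorname{mod} A,\mathrm{Ab})$, i.e. contains $0$ and is closed under subobjects, quotients and extensions. An ideal $\mathcal{J}$ is \emph{covariantly finite} if for every $X\in\operatorname{mod} A$ there is a morphism $f\colon X\to M$ in $\mathcal{J}$ through which every morphism of $\mathcal{J}$ starting in $X$ factors, and \emph{contravariantly finite} if for every $Y\in\operatorname{mod} A$ there is a morphism $f\colon M\to Y$ in $\mathcal{J}$ through which every morphism of $\mathcal{J}$ ending in $Y$ factors. A collection of ideals is \emph{directed} if it is non-empty and any two of its members contain a common third member. Theorem. An ideal $\mathcal{I}$ of $\operatorname{mod} A$ is fp-idempotent if and only if there is a collection of ideals $\{\mathcal{J}_i\}_{i\in I}$ such that $$\mathcal{I}=\bigcap_{i\in I}\mathcal{J}_i^\omega$$ and the collection $\{\mathcal{J}_i^\omega\}_{i\in I}$ is directed. Moreover, if $\mathcal{I}$ is fp-idempotent, then $\{\mathcal{J}_i\}_{i\in I}$ can be chosen such that the collection $\{\mathcal{J}_i\}_{i\in I}$ is itself directed and all $\mathcal{J}_i$ are covariantly finite,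 and it can also be chosen such that $\{\mathcal{J}_i\}_{i\in I}$ is itself directed and all $\mathcal{J}_i$ are contravariantly finite. -/

import Mathlib

open CategoryTheory CategoryTheory.Limits

noncomputable section

universe v u

/-- A (two-sided) ideal of morphisms in a preadditive category: a subgroup of every
group of morphisms, stable under composition with arbitrary morphisms on both sides. -/
@[ext]
structure HomIdeal (C : Type u) [Category.{v} C] [Preadditive C] where
  /-- the morphisms `X ⟶ Y` that lie in the ideal -/
  hom (X Y : C) : AddSubgroup (X ⟶ Y)
  comp_mem {W X Y Z : C} (α : W ⟶ X) {f : X ⟶ Y} (β : Y ⟶ Z) (hf : f ∈ hom X Y) :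
    α ≫ f ≫ β ∈ hom W Z

namespace HomIdeal

variable {C : Type u} [Category.{v} C] [Preadditive C]

/-- Ideals are ordered by inclusion. -/
instance : PartialOrder (HomIdeal C) where
  le I J := ∀ X Y : C, I.hom X Y ≤ J.hom X Y
  le_refl _ _ _ := le_rfl
  le_trans _ _ _ h₁ h₂ X Y := (h₁ X Y).trans (h₂ X Y)
  le_antisymm _ _ h₁ h₂ := HomIdeal.ext (funext₂ fun X Y => le_antisymm (h₁ X Y) (h₂ X Y))

/-- The intersection of a collection of ideals. -/
instance : InfSet (HomIdeal C) where
  sInf 𝒥 :=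
    { hom := fun X Y => ⨅ J ∈ 𝒥, J.hom X Y
      comp_mem := by
        intro W X Y Z α f β hf
        simp only [AddSubgroup.mem_iInf] at hf ⊢
        exact fun J hJ => J.comp_mem α β (hf J hJ) }

/-- The ideal of all morphisms. -/
instance : One (HomIdeal C) where
  one :=
    { hom := fun _ _ => ⊤
      comp_mem := fun _ _ _ _ => AddSubgroup.mem_top _ }

/-- The product of two ideals: all finite sums of composites of a morphism in one of them
and a morphism in the other. -/
instance : Mul (HomIdeal C) where
  mul I J :=
    { hom := fun X Y => AddSubgroup.closure
        {h | ∃ (Z : C) (f : X ⟶ Z) (g : Z ⟶ Y), f ∈ J.hom X Z ∧ g ∈ I.hom Z Y ∧ h = f ≫ g}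
      comp_mem := by
        intro W X Y Z α f β hf
        induction hf using AddSubgroup.closure_induction with
        | mem h hh =>
          obtain ⟨V, f, g, hf, hg, rfl⟩ := hh
          refine AddSubgroup.subset_closure ⟨V, α ≫ f, g ≫ β, ?_, ?_, by simp⟩
          · simpa using J.comp_mem α (𝟙 V) hf
          · simpa using I.comp_mem (𝟙 V) β hg
        | zero => simp
        | add f g _ _ hf hg => simpa using add_mem hf hg
        | neg f _ hf => simpa using hf }

/-- The powers of an ideal: `J ^ 0` consists of all morphisms and `J ^ (n + 1) = J ^ n * J`. -/
instance : Pow (HomIdeal C) ℕ where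
  pow J n := npowRec n J

/-- `J ^ ω`, the intersection of the powers `J ^ n` with `n ≥ 1`. -/
def omegaPow (J : HomIdeal C) : HomIdeal C := ⨅ n : ℕ, J ^ (n + 1)

variable (I : HomIdeal C)

/-- `f : X ⟶ M` is left `I`-factoring if every morphism of `I` starting in `X` factors
through `f`. -/
def IsLeftFactoring {X M : C} (f : X ⟶ M) : Prop :=
  ∀ ⦃Y : C⦄ (φ : X ⟶ Y), φ ∈ I.hom X Y → ∃ g : M ⟶ Y, φ = f ≫ g

/-- `f : M ⟶ Y` is right `I`-factoring if every morphism of `I` ending in `Y` factors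
through `f`. -/
def IsRightFactoring {M Y : C} (f : M ⟶ Y) : Prop :=
  ∀ ⦃X : C⦄ (φ : X ⟶ Y), φ ∈ I.hom X Y → ∃ g : X ⟶ M, φ = g ≫ f

/-- Every object `X` has a left `I`-approximation: a left `I`-factoring morphism
`X ⟶ M` which belongs to `I`. -/
def IsCovariantlyFinite : Prop :=
  ∀ X : C, ∃ (M : C) (f : X ⟶ M), f ∈ I.hom X M ∧ I.IsLeftFactoring f

/-- Every object `Y` has a right `I`-approximation: a right `I`-factoring morphism
`M ⟶ Y` which belongs to `I`. -/
def IsContravariantlyFinite : Prop :=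
  ∀ Y : C, ∃ (M : C) (f : M ⟶ Y), f ∈ I.hom M Y ∧ I.IsRightFactoring f

end HomIdeal

/-- A functor `C ⥤ Ab` is finitely presented if it is isomorphic to the cokernel of
`Hom(f, -) : Hom(Y, -) ⟶ Hom(X, -)` for some morphism `f : X ⟶ Y`.
(Such a functor is automatically additive.) -/
def isFinitelyPresentedFunctor (C : Type u) [Category.{v} C] [Preadditive C] :
    ObjectProperty (C ⥤ AddCommGrpCat.{v}) :=
  fun F => ∃ (X Y : C) (f : X ⟶ Y), Nonempty (F ≅ cokernel (preadditiveCoyoneda.map f.op))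

/-- The category `fp(C, Ab)` of finitely presented functors. -/
abbrev FpFunctor (C : Type u) [Category.{v} C] [Preadditive C] :=
  (isFinitelyPresentedFunctor C).FullSubcategory

/-- Serre subcategories: they contain a zero object and are closed under subobjects, quotients
and extensions. This is `CategoryTheory.ObjectProperty.IsSerreClass`, phrased so that it does
not require an instance of `Abelian D` to be provided. -/
structure IsSerreSubcategory {D : Type u} [Category.{v} D] [HasZeroMorphisms D]
    (P : ObjectProperty D) : Prop where
  containsZero : P.ContainsZero
  isClosedUnderSubobjects : P.IsClosedUnderSubobjects
  isClosedUnderQuotients : P.IsClosedUnderQuotients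
  isClosedUnderExtensions : P.IsClosedUnderExtensions

namespace HomIdeal

variable {C : Type u} [Category.{v} C] [Preadditive C] (I : HomIdeal C)

/-- The finitely presented functors that vanish on all morphisms of `I`. -/
def annihilatedFunctors : ObjectProperty (FpFunctor C) :=
  fun F => ∀ ⦃X Y : C⦄ (f : X ⟶ Y), f ∈ I.hom X Y → F.obj.map f = 0

/-- An ideal is fp-idempotent if the finitely presented functors that vanish on it form a
Serre subcategory of `fp(C, Ab)`. -/
def IsFpIdempotent : Prop := IsSerreSubcategory I.annihilatedFunctors

end HomIdeal

/-- The category `mod A` of left `A`-modules of finite length. -/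
abbrev FinLengthModuleCat (A : Type u) [Ring A] :=
  ObjectProperty.FullSubcategory (fun M : ModuleCat.{u} A => IsFiniteLength A M)

end

/-! A finitely presented functor `F = coker Hom(f, -)` vanishes on `I` exactly when every morphism
of `I` starting in the source of `f` factors through `f` (`annihilatedFunctors_fpCoker_iff`).
Monomorphisms and epimorphisms of finitely presented functors are pointwise, so closure under
subobjects and quotients is automatic, and fp-idempotence reduces to closure under extensions
(`isFpIdempotent_iff`).

Suppose `I` is the intersection of the directed family of the `J ^ ω`. A finitely presented functor
killed by a directed intersection of ideals is already killed by one member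
(`exists_isLeftFactoring_of_sInf`): factoring through `f` is tested by a functional on one module
`Hom(X, Z)`, which is artinian. Applied to the ideals `J ^ ω` and then to the powers of a single
`J`, this shows that the ends of an extension are killed by some `J ^ m` and `J ^ n`. The middle is
then killed by `J ^ (m + n)`, hence by `I`.

Conversely, for fp-idempotent `I` take the ideals `factorIdeal f`, the annihilators of the functors
`coker Hom(f, -)` that vanish on `I`. They are directed via biproducts and are both covariantly and
contravariantly finite. Closure under extensions makes left `I`-factoring morphisms composable
(`IsFpIdempotent.isLeftFactoring_comp`). Iterating left approximations therefore gives `I ≤ J ^ ω`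
for each covariantly finite `J` containing `I`. A morphism outside `I` is excluded by a functional
that vanishes on `I` but not on it.

The duality arguments use only `IsDualizingModule`. For `mod A` it follows from Matlis duality over
the base ring: an injective hull of the product of the residue fields is a finite length injective
cogenerator `E`, and `Hom_k(A, E)` provides the injective modules that present the functors dual to
`Hom`. -/

noncomputable section

universe v u w

namespace HomIdeal

/-! ### Ideals, their products and powers. -/

section Basic

variable {C : Type u} [Category.{v} C] [Preadditive C]

lemma comp_right_mem (I : HomIdeal C) {X Y Z : C} {f : X ⟶ Y} (hf : f ∈ I.hom X Y) (g : Y ⟶ Z) :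
    f ≫ g ∈ I.hom X Z := by
  simpa using I.comp_mem (𝟙 X) g hf

lemma comp_left_mem (I : HomIdeal C) {X Y Z : C} (f : X ⟶ Y) {g : Y ⟶ Z} (hg : g ∈ I.hom Y Z) :
    f ≫ g ∈ I.hom X Z := by
  simpa using I.comp_mem f (𝟙 Z) hg

lemma mem_sInf {𝒥 : Set (HomIdeal C)} {X Y : C} {f : X ⟶ Y} :
    f ∈ (sInf 𝒥).hom X Y ↔ ∀ J ∈ 𝒥, f ∈ J.hom X Y := by
  change f ∈ ⨅ J ∈ 𝒥, J.hom X Y ↔ _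
  simp [AddSubgroup.mem_iInf]

lemma comp_mem_mul {I J : HomIdeal C} {X Y Z : C} {f : X ⟶ Y} {g : Y ⟶ Z}
    (hf : f ∈ J.hom X Y) (hg : g ∈ I.hom Y Z) : f ≫ g ∈ (I * J).hom X Z :=
  AddSubgroup.subset_closure ⟨Y, f, g, hf, hg, rfl⟩

lemma mul_le_iff {I J K : HomIdeal C} :
    I * J ≤ K ↔ ∀ ⦃X Y Z : C⦄ (f : X ⟶ Y) (g : Y ⟶ Z), f ∈ J.hom X Y → g ∈ I.hom Y Z →
      f ≫ g ∈ K.hom X Z := by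
  refine ⟨fun h X Y Z f g hf hg => h _ _ (comp_mem_mul hf hg), fun h X Z => ?_⟩
  refine (AddSubgroup.closure_le _).2 ?_
  rintro _ ⟨Y, f, g, hf, hg, rfl⟩
  exact h f g hf hg

lemma mul_mono {I I' J J' : HomIdeal C} (h : I ≤ I') (h' : J ≤ J') : I * J ≤ I' * J' :=
  mul_le_iff.2 fun _ _ _ _ _ hf hg => comp_mem_mul (h' _ _ hf) (h _ _ hg)

lemma mul_le_left (I J : HomIdeal C) : I * J ≤ I :=
  mul_le_iff.2 fun _ _ _ f _ _ hg => I.comp_left_mem f hg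

lemma mul_le_right (I J : HomIdeal C) : I * J ≤ J :=
  mul_le_iff.2 fun _ _ _ _ g hf _ => J.comp_right_mem hf g

lemma pow_succ' (J : HomIdeal C) (n : ℕ) : J ^ (n + 1) = J ^ n * J := rfl

lemma pow_mono {I J : HomIdeal C} (h : I ≤ J) (n : ℕ) : I ^ n ≤ J ^ n := by
  induction n with
  | zero => exact le_rfl
  | succ n ih => exact mul_mono ih h

lemma pow_antitone (J : HomIdeal C) : Antitone fun n : ℕ => J ^ n :=
  antitone_nat_of_succ_le fun n => mul_le_left (J ^ n) J

lemma pow_one_le (J : HomIdeal C) : J ^ 1 ≤ J := mul_le_right _ _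

lemma comp_mem_pow_succ {J : HomIdeal C} {n : ℕ} {X Y Z : C} {f : X ⟶ Y} {g : Y ⟶ Z}
    (hf : f ∈ J.hom X Y) (hg : g ∈ (J ^ n).hom Y Z) : f ≫ g ∈ (J ^ (n + 1)).hom X Z :=
  comp_mem_mul hf hg

lemma pow_add_le (J : HomIdeal C) (m n : ℕ) : J ^ (m + n) ≤ J ^ m * J ^ n := by
  induction n with
  | zero =>
    intro X Y f hf
    have := comp_mem_mul (I := J ^ m) (J := J ^ 0) (f := 𝟙 X) (AddSubgroup.mem_top _) hf
    simpa using this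
  | succ n ih =>
    refine (mul_mono ih le_rfl : J ^ (m + n) * J ≤ _).trans (mul_le_iff.2 fun X Y Z f g hf hg => ?_)
    rw [pow_succ']
    induction hg using AddSubgroup.closure_induction with
    | mem h hh =>
      obtain ⟨V, a, b, ha, hb, rfl⟩ := hh
      -- No monoid structure on ideals is available, so the regrouping is done on composites of
      -- morphisms.
      rw [← Category.assoc]
      exact comp_mem_mul (comp_mem_mul hf ha) hb
    | zero => simp
    | add a b _ _ ha hb => simpa using add_mem ha hb
    | neg a _ ha => simpa using ha

lemma mem_omegaPow {J : HomIdeal C} {X Y : C} {f : X ⟶ Y} :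
    f ∈ J.omegaPow.hom X Y ↔ ∀ n : ℕ, f ∈ (J ^ (n + 1)).hom X Y := by
  rw [omegaPow, iInf, mem_sInf, Set.forall_mem_range]

lemma omegaPow_mono {I J : HomIdeal C} (h : I ≤ J) : I.omegaPow ≤ J.omegaPow :=
  fun _ _ _ hf => mem_omegaPow.2 fun n => pow_mono h _ _ _ (mem_omegaPow.1 hf n)

lemma omegaPow_le (J : HomIdeal C) : J.omegaPow ≤ J :=
  fun _ _ _ hf => pow_one_le J _ _ (mem_omegaPow.1 hf 0)

lemma omegaPow_le_pow (J : HomIdeal C) (n : ℕ) : J.omegaPow ≤ J ^ (n + 1) :=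
  fun _ _ _ hf => mem_omegaPow.1 hf n

/-- The morphisms of an ideal of a linear category, as a submodule. -/
def homSubmodule (k : Type w) [Semiring k] [Linear k C] (I : HomIdeal C) (X Y : C) :
    Submodule k (X ⟶ Y) where
  __ := I.hom X Y
  smul_mem' c f hf := by
    have := I.comp_right_mem hf (c • 𝟙 Y)
    rwa [Linear.comp_smul, Category.comp_id] at this

end Basic

end HomIdeal

/-! ### Finitely presented functors and pointwise exactness. -/

section FpFunctor

open Opposite

variable {C : Type u} [Category.{v} C] [Preadditive C]

/-- The finitely presented functor `coker Hom(f, -)`. -/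
def fpCoker {X Y : C} (f : X ⟶ Y) : FpFunctor C :=
  ⟨cokernel (preadditiveCoyoneda.map f.op), X, Y, f, ⟨Iso.refl _⟩⟩

namespace fpCoker

variable {X Y : C} (f : X ⟶ Y)

/-- The class of a morphism in `coker Hom(f, -)`. -/
def mk (V : C) : (X ⟶ V) →+ (fpCoker f).obj.obj V :=
  ((cokernel.π (preadditiveCoyoneda.map f.op)).app V).hom

lemma mk_surjective (V : C) : Function.Surjective (mk f V) := by
  have : Epi ((cokernel.π (preadditiveCoyoneda.map f.op)).app V) := inferInstance
  exact (AddCommGrpCat.epi_iff_surjective _).1 this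

lemma mk_eq_zero_iff {V : C} (h : X ⟶ V) : mk f V h = 0 ↔ ∃ g : Y ⟶ V, h = f ≫ g := by
  let S : ShortComplex (C ⥤ AddCommGrpCat.{v}) :=
    ShortComplex.mk (preadditiveCoyoneda.map f.op) (cokernel.π _) (cokernel.condition _)
  have hS : S.Exact := ShortComplex.exact_cokernel _
  have hS' := hS.map ((evaluation C AddCommGrpCat.{v}).obj V)
  rw [ShortComplex.ab_exact_iff] at hS'
  constructor
  · intro hh
    obtain ⟨g, hg⟩ := hS' h hh
    exact ⟨g, hg.symm⟩
  · rintro ⟨g, rfl⟩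
    have := congr($(S.zero).app V g)
    exact this

lemma map_mk {V W : C} (h : X ⟶ V) (t : V ⟶ W) :
    (fpCoker f).obj.map t (mk f V h) = mk f W (h ≫ t) := by
  have := congr($((cokernel.π (preadditiveCoyoneda.map f.op)).naturality t) h)
  exact this.symm

lemma map_add_of_iso (F : C ⥤ AddCommGrpCat.{v}) (e : F ≅ (fpCoker f).obj) {V W : C}
    (s t : V ⟶ W) : F.map (s + t) = F.map s + F.map t := by
  have key : (fpCoker f).obj.map (s + t) = (fpCoker f).obj.map s + (fpCoker f).obj.map t := by
    ext x
    obtain ⟨h, rfl⟩ := mk_surjective f V x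
    change (fpCoker f).obj.map (s + t) _ =
      (fpCoker f).obj.map s (mk f V h) + (fpCoker f).obj.map t (mk f V h)
    simp only [map_mk, Preadditive.comp_add, map_add]
  rw [← cancel_mono (e.hom.app W), e.hom.naturality, key, Preadditive.comp_add,
    Preadditive.add_comp, e.hom.naturality, e.hom.naturality]

end fpCoker

lemma FpFunctor.exists_iso (F : FpFunctor C) :
    ∃ (X Y : C) (f : X ⟶ Y), Nonempty (F ≅ fpCoker f) := by
  obtain ⟨X, Y, f, ⟨e⟩⟩ := F.property
  exact ⟨X, Y, f, ⟨ObjectProperty.isoMk _ e⟩⟩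

instance FpFunctor.additive (F : FpFunctor C) : F.obj.Additive where
  map_add := by
    obtain ⟨X, Y, f, ⟨e⟩⟩ := F.property
    intro V W s t
    exact fpCoker.map_add_of_iso f F.obj e s t

namespace FpFunctor

lemma map_add_apply (F : FpFunctor C) {V W : C} (s t : V ⟶ W) (x : F.obj.obj V) :
    F.obj.map (s + t) x = F.obj.map s x + F.obj.map t x := by
  rw [F.obj.map_add]; rfl

lemma map_zero_apply (F : FpFunctor C) {V W : C} (x : F.obj.obj V) :
    F.obj.map (0 : V ⟶ W) x = 0 := by
  rw [F.obj.map_zero]; rfl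

lemma map_comp_apply (F : FpFunctor C) {U V W : C} (s : U ⟶ V) (t : V ⟶ W) (x : F.obj.obj U) :
    F.obj.map (s ≫ t) x = F.obj.map t (F.obj.map s x) := by
  rw [F.obj.map_comp]; rfl

lemma map_id_apply (F : FpFunctor C) {V : C} (x : F.obj.obj V) :
    F.obj.map (𝟙 V) x = x := by
  rw [F.obj.map_id]; rfl

lemma naturality_apply {F G : FpFunctor C} (φ : F ⟶ G) {V W : C} (t : V ⟶ W) (x : F.obj.obj V) :
    φ.hom.app W (F.obj.map t x) = G.obj.map t (φ.hom.app V x) :=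
  congr($(φ.hom.naturality t) x)

lemma hom_ext_apply {F G : FpFunctor C} {φ ψ : F ⟶ G}
    (h : ∀ (V : C) (x : F.obj.obj V), φ.hom.app V x = ψ.hom.app V x) : φ = ψ := by
  ext V x
  exact h V x

end FpFunctor

namespace fpCoker

variable {X Y : C} {f : X ⟶ Y}

/-- The natural transformation `Hom(X, -) ⟶ G` given by an element of `G X`. -/
def coyonedaMap (G : FpFunctor C) (y : G.obj.obj X) :
    preadditiveCoyoneda.obj (op X) ⟶ G.obj where
  app V := AddCommGrpCat.ofHom (AddMonoidHom.mk' (fun h : X ⟶ V => G.obj.map h y)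
    fun s t => G.map_add_apply s t y)
  naturality V W t := by
    ext h
    exact G.map_comp_apply h t y

/-- The morphism `coker Hom(f, -) ⟶ G` given by an element `y` of `G X` which vanishes in
`G Y`. -/
def desc (G : FpFunctor C) (y : G.obj.obj X) (hy : G.obj.map f y = 0) : fpCoker f ⟶ G :=
  ObjectProperty.homMk (cokernel.desc _ (coyonedaMap G y) (by
    ext V h
    exact (G.map_comp_apply f h y).trans (by rw [hy, map_zero]; rfl)))

lemma desc_mk (G : FpFunctor C) (y : G.obj.obj X) (hy : G.obj.map f y = 0) {V : C} (h : X ⟶ V) :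
    (desc G y hy).hom.app V (mk f V h) = G.obj.map h y :=
  congr(($(cokernel.π_desc _ (coyonedaMap G y) _)).app V h)

lemma mk_eq_map (V : C) (h : X ⟶ V) :
    mk f V h = (fpCoker f).obj.map h (mk f X (𝟙 X)) := by
  rw [map_mk, Category.id_comp]

lemma map_mk_id_eq_zero : (fpCoker f).obj.map f (mk f X (𝟙 X)) = 0 := by
  rw [map_mk, mk_eq_zero_iff]
  exact ⟨𝟙 _, by simp⟩

lemma hom_ext {G : FpFunctor C} {φ ψ : fpCoker f ⟶ G}
    (h : φ.hom.app X (mk f X (𝟙 X)) = ψ.hom.app X (mk f X (𝟙 X))) : φ = ψ := by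
  refine FpFunctor.hom_ext_apply fun V x => ?_
  obtain ⟨t, rfl⟩ := mk_surjective f V x
  rw [mk_eq_map, FpFunctor.naturality_apply, FpFunctor.naturality_apply, h]

end fpCoker

namespace FpFunctor

/-- The functor `Hom(V, -)` is the cokernel attached to `V ⟶ 0`, so by Yoneda an element of the
kernel at `V` is a morphism in the category that `φ` kills. -/
lemma app_injective_of_mono [HasZeroObject C] {F G : FpFunctor C} (φ : F ⟶ G) [Mono φ] (V : C) :
    Function.Injective (φ.hom.app V) := by
  refine (injective_iff_map_eq_zero ((φ.hom.app V).hom)).2 fun x hx => ?_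
  open ZeroObject in
  have h0 : F.obj.map (0 : V ⟶ (0 : C)) x = 0 := F.map_zero_apply x
  have : fpCoker.desc F x h0 = 0 := by
    rw [← cancel_mono φ, zero_comp]
    refine fpCoker.hom_ext ?_
    change φ.hom.app V ((fpCoker.desc F x h0).hom.app V _) = 0
    rw [fpCoker.desc_mk, F.map_id_apply]
    exact hx
  have h2 := fpCoker.desc_mk F x h0 (𝟙 V)
  rw [this, F.map_id_apply] at h2
  exact h2.symm

/-- The pointwise cokernel of a morphism `coker Hom(f, -) ⟶ coker Hom(g, -)` induced by `a` is again
finitely presented, by `(a, g)`. An epimorphism makes the projection onto it zero, so the identity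
of the source of `g` factors through `(a, g)`. -/
lemma app_surjective_of_epi [HasBinaryBiproducts C] {F G : FpFunctor C} (φ : F ⟶ G) [Epi φ]
    (V : C) : Function.Surjective (φ.hom.app V) := by
  obtain ⟨X, Y, f, ⟨e⟩⟩ := F.exists_iso
  obtain ⟨X', Y', g, ⟨e'⟩⟩ := G.exists_iso
  let φ' : fpCoker f ⟶ fpCoker g := e.inv ≫ φ ≫ e'.hom
  have : Epi φ' := inferInstance
  obtain ⟨a, ha⟩ := fpCoker.mk_surjective g X (φ'.hom.app X (fpCoker.mk f X (𝟙 X)))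
  let l := biprod.lift a g
  let ψ : fpCoker g ⟶ fpCoker l := fpCoker.desc _ (fpCoker.mk l X' (𝟙 X')) (by
    rw [fpCoker.map_mk, fpCoker.mk_eq_zero_iff]
    exact ⟨biprod.snd, by simp [l]⟩)
  have hψ : ψ = 0 := by
    rw [← cancel_epi φ', comp_zero]
    refine fpCoker.hom_ext ?_
    change ψ.hom.app X (φ'.hom.app X _) = 0
    rw [← ha, fpCoker.desc_mk, fpCoker.map_mk, fpCoker.mk_eq_zero_iff]
    exact ⟨biprod.fst, by simp [l]⟩
  have h1 := fpCoker.desc_mk (fpCoker l) (fpCoker.mk l X' (𝟙 X')) (f := g) (by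
    rw [fpCoker.map_mk, fpCoker.mk_eq_zero_iff]
    exact ⟨biprod.snd, by simp [l]⟩) (𝟙 X')
  change ψ.hom.app X' _ = _ at h1
  rw [hψ, map_id_apply] at h1
  obtain ⟨r, hr⟩ := (fpCoker.mk_eq_zero_iff l (𝟙 X')).1 h1.symm
  have hr' : 𝟙 X' = a ≫ biprod.inl ≫ r + g ≫ biprod.inr ≫ r := by
    rw [hr, show l = _ from biprod.lift_eq]; simp
  have key : Function.Surjective (φ'.hom.app V) := by
    intro y
    obtain ⟨h, rfl⟩ := fpCoker.mk_surjective g V y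
    refine ⟨fpCoker.mk f V ((biprod.inl ≫ r) ≫ h), ?_⟩
    rw [fpCoker.mk_eq_map, naturality_apply, ← ha, fpCoker.map_mk, ← sub_eq_zero, ← map_sub,
      fpCoker.mk_eq_zero_iff]
    refine ⟨-(biprod.inr ≫ r ≫ h), ?_⟩
    have := congr($hr' ≫ h)
    simp only [Category.id_comp, Preadditive.add_comp, Category.assoc] at this
    simp only [Category.assoc, Preadditive.comp_neg]
    rw [eq_neg_iff_add_eq_zero, sub_add_eq_add_sub, ← this, sub_self]
  intro y
  obtain ⟨x, hx⟩ := key (e'.hom.hom.app V y)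
  refine ⟨e.inv.hom.app V x, ?_⟩
  have h3 : e'.inv.hom.app V (φ'.hom.app V x) = φ.hom.app V (e.inv.hom.app V x) := by
    change (φ' ≫ e'.inv).hom.app V x = (e.inv ≫ φ).hom.app V x
    simp [φ']
  rw [← h3, hx]
  change (e'.hom ≫ e'.inv).hom.app V y = y
  rw [e'.hom_inv_id]; rfl

lemma mono_of_app_injective {F G : FpFunctor C} (φ : F ⟶ G)
    (h : ∀ V, Function.Injective (φ.hom.app V)) : Mono φ where
  right_cancellation _ _ hab := hom_ext_apply fun V x => h V
    congr(($hab).hom.app V x)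

lemma epi_of_app_surjective {F G : FpFunctor C} (φ : F ⟶ G)
    (h : ∀ V, Function.Surjective (φ.hom.app V)) : Epi φ where
  left_cancellation _ _ hab := hom_ext_apply fun V y => by
    obtain ⟨x, rfl⟩ := h V y
    exact congr(($hab).hom.app V x)

/-- The middle term of a short exact sequence of finitely presented functors is pointwise exact. -/
lemma exists_of_exact [HasZeroObject C] [HasBinaryBiproducts C] {S : ShortComplex (FpFunctor C)}
    (hS : S.Exact) {V : C} (x : S.X₂.obj.obj V) (hx : S.g.hom.app V x = 0) :
    ∃ y : S.X₁.obj.obj V, S.f.hom.app V y = x := by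
  obtain ⟨h, h0⟩ := hS.condition
  -- Zero homology means that the cokernel of the map from `S.X₁` to the kernel of `S.g` is zero.
  have hepi : Epi h.left.f' := by
    refine Preadditive.epi_of_cancel_zero _ fun {Z} t ht => ?_
    rw [← h.left.π_descH t ht, h0.eq_of_tgt h.left.π 0, zero_comp]
  open ZeroObject in
  have hz : S.X₂.obj.map (0 : V ⟶ (0 : C)) x = 0 := S.X₂.map_zero_apply x
  let a := fpCoker.desc S.X₂ x hz
  have ha : a ≫ S.g = 0 := by
    refine fpCoker.hom_ext ?_
    change S.g.hom.app V (a.hom.app V _) = 0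
    rw [fpCoker.desc_mk, map_id_apply, hx]
  obtain ⟨y, hy⟩ := app_surjective_of_epi h.left.f' V
    ((h.left.liftK a ha).hom.app V (fpCoker.mk _ V (𝟙 V)))
  refine ⟨y, ?_⟩
  have h4 : S.f.hom.app V y = h.left.i.hom.app V (h.left.f'.hom.app V y) :=
    congr(($(h.left.f'_i.symm)).hom.app V y)
  have h5 : h.left.i.hom.app V ((h.left.liftK a ha).hom.app V (fpCoker.mk _ V (𝟙 V)))
      = a.hom.app V (fpCoker.mk _ V (𝟙 V)) :=
    congr(($(h.left.liftK_i a ha)).hom.app V _)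
  rw [h4, hy, h5, fpCoker.desc_mk, map_id_apply]

end FpFunctor
end FpFunctor

/-! ### Functors annihilated by an ideal, and extensions. -/

section Annihilated

variable {C : Type u} [Category.{v} C] [Preadditive C]

namespace FpFunctor

variable {S : ShortComplex (FpFunctor C)}

/-- `T` is generated by one element subject to one relation. Its image lifts to `S.X₁`, and the lift
inherits the relation by injectivity. -/
lemma exists_lift_of_app_exact (hf : ∀ V, Function.Injective (S.f.hom.app V))
    (hfg : ∀ (V : C) (x : S.X₂.obj.obj V), S.g.hom.app V x = 0 → ∃ y, S.f.hom.app V y = x)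
    {T : FpFunctor C} (t : T ⟶ S.X₂) (ht : t ≫ S.g = 0) : ∃ l : T ⟶ S.X₁, l ≫ S.f = t := by
  obtain ⟨X, Y, h, ⟨e⟩⟩ := T.exists_iso
  let t' := e.inv ≫ t
  let x := t'.hom.app X (fpCoker.mk h X (𝟙 X))
  obtain ⟨y, hy⟩ := hfg X x (by
    change (t' ≫ S.g).hom.app X _ = 0
    rw [Category.assoc, ht, comp_zero]; rfl)
  have hy0 : S.X₁.obj.map h y = 0 := by
    apply hf
    rw [naturality_apply, hy, ← naturality_apply, fpCoker.map_mk_id_eq_zero, map_zero, map_zero]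
  refine ⟨e.hom ≫ fpCoker.desc S.X₁ y hy0, ?_⟩
  rw [Category.assoc, ← Iso.eq_inv_comp]
  refine fpCoker.hom_ext ?_
  change S.f.hom.app X ((fpCoker.desc S.X₁ y hy0).hom.app X _) = x
  rw [fpCoker.desc_mk, map_id_apply, hy]

/-- The generator of `S.X₃` is lifted to `S.X₂` and pushed along `t`; the choice of lift is harmless
because `t` kills the pointwise kernel of `S.g`. -/
lemma exists_desc_of_app_exact (hg : ∀ V, Function.Surjective (S.g.hom.app V))
    (hfg : ∀ (V : C) (x : S.X₂.obj.obj V), S.g.hom.app V x = 0 → ∃ y, S.f.hom.app V y = x)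
    {T : FpFunctor C} (t : S.X₂ ⟶ T) (ht : S.f ≫ t = 0) : ∃ l : S.X₃ ⟶ T, S.g ≫ l = t := by
  have key : ∀ (V : C) (x : S.X₂.obj.obj V), S.g.hom.app V x = 0 → t.hom.app V x = 0 := by
    intro V x hx
    obtain ⟨y, rfl⟩ := hfg V x hx
    exact congr(($ht).hom.app V y)
  obtain ⟨X, Y, h, ⟨e⟩⟩ := S.X₃.exists_iso
  obtain ⟨x, hx⟩ := hg X (e.inv.hom.app X (fpCoker.mk h X (𝟙 X)))
  have hx0 : T.obj.map h (t.hom.app X x) = 0 := by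
    rw [← naturality_apply]
    apply key
    rw [naturality_apply, hx, ← naturality_apply, fpCoker.map_mk_id_eq_zero, map_zero]
  refine ⟨e.hom ≫ fpCoker.desc T (t.hom.app X x) hx0, hom_ext_apply fun V z => ?_⟩
  change (fpCoker.desc T (t.hom.app X x) hx0).hom.app V ((S.g ≫ e.hom).hom.app V z) = _
  obtain ⟨s, hs⟩ := fpCoker.mk_surjective h V ((S.g ≫ e.hom).hom.app V z)
  rw [← hs, fpCoker.desc_mk, ← naturality_apply, ← sub_eq_zero, ← map_sub]
  apply key
  have hz : S.g.hom.app V z = e.inv.hom.app V ((S.g ≫ e.hom).hom.app V z) := by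
    change _ = ((S.g ≫ e.hom) ≫ e.inv).hom.app V z
    simp
  rw [map_sub, naturality_apply, hx, hz, ← hs, ← naturality_apply, fpCoker.map_mk,
    Category.id_comp, sub_self]

lemma isZero_fpCoker_id (X : C) : IsZero (fpCoker (𝟙 X)) := by
  rw [IsZero.iff_id_eq_zero]
  refine fpCoker.hom_ext ?_
  exact (fpCoker.mk_eq_zero_iff _ _).2 ⟨𝟙 X, by simp⟩

/-- A pointwise short exact sequence of finitely presented functors is short exact. -/
lemma shortExact_of_app [HasZeroObject C] (hf : ∀ V, Function.Injective (S.f.hom.app V))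
    (hg : ∀ V, Function.Surjective (S.g.hom.app V))
    (hfg : ∀ (V : C) (x : S.X₂.obj.obj V), S.g.hom.app V x = 0 → ∃ y, S.f.hom.app V y = x) :
    S.ShortExact := by
  have := mono_of_app_injective S.f hf
  have := epi_of_app_surjective S.g hg
  choose lift hlift using @exists_lift_of_app_exact _ _ _ S hf hfg
  choose desc hdesc using @exists_desc_of_app_exact _ _ _ S hg hfg
  open ZeroObject in
  let Z : FpFunctor C := fpCoker (𝟙 (0 : C))
  have hZ : IsZero Z := isZero_fpCoker_id _
  let hi : IsLimit (KernelFork.ofι S.f S.zero) :=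
    KernelFork.IsLimit.ofι' S.f S.zero fun t ht => ⟨lift t ht, hlift t ht⟩
  let hp : IsColimit (CokernelCofork.ofπ S.g S.zero) :=
    CokernelCofork.IsColimit.ofπ' S.g S.zero fun t ht => ⟨desc t ht, hdesc t ht⟩
  -- With `K = S.X₁` and `Q = S.X₃`, the comparison maps are identities, so zero serves as the
  -- homology on both sides.
  have h1 : hi.lift (KernelFork.ofι S.f S.zero) = 𝟙 _ := by
    rw [← cancel_mono S.f]
    exact (hi.fac _ WalkingParallelPair.zero).trans (Category.id_comp _).symm
  have h2 : hp.desc (CokernelCofork.ofπ S.g S.zero) = 𝟙 _ := by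
    rw [← cancel_epi S.g]
    exact (hp.fac _ WalkingParallelPair.one).trans (Category.comp_id _).symm
  let left : S.LeftHomologyData :=
    { K := S.X₁, H := Z, i := S.f, π := 0, wi := S.zero, hi := hi, wπ := comp_zero
      hπ := CokernelCofork.IsColimit.ofEpiOfIsZero _
        (by rw [h1]; exact inferInstanceAs (Epi (𝟙 S.X₁))) hZ }
  let right : S.RightHomologyData :=
    { Q := S.X₃, H := Z, p := S.g, ι := 0, wp := S.zero, hp := hp, wι := zero_comp
      hι := KernelFork.IsLimit.ofMonoOfIsZero _
        (by rw [h2]; exact inferInstanceAs (Mono (𝟙 S.X₃))) hZ }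
  exact
    { exact := ⟨⟨{ left := left, right := right, iso := Iso.refl _,
                    comm := by simp [left, right, S.zero] }, hZ⟩⟩ }

end FpFunctor

namespace HomIdeal

variable (I : HomIdeal C)

lemma annihilatedFunctors_iff {F : FpFunctor C} :
    I.annihilatedFunctors F ↔ ∀ ⦃X Y : C⦄ (f : X ⟶ Y), f ∈ I.hom X Y →
      ∀ x : F.obj.obj X, F.obj.map f x = 0 :=
  forall_congr' fun X => forall_congr' fun Y => forall_congr' fun f => forall_congr' fun _ =>
    ⟨fun h x => by rw [h]; rfl, fun h => by ext x; exact h x⟩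

lemma annihilatedFunctors_of_injective {F G : FpFunctor C} (φ : F ⟶ G)
    (hφ : ∀ V, Function.Injective (φ.hom.app V)) (hG : I.annihilatedFunctors G) :
    I.annihilatedFunctors F := by
  rw [annihilatedFunctors_iff] at hG ⊢
  intro X Y f hf x
  apply hφ
  rw [FpFunctor.naturality_apply, hG f hf, map_zero]

lemma annihilatedFunctors_of_surjective {F G : FpFunctor C} (φ : F ⟶ G)
    (hφ : ∀ V, Function.Surjective (φ.hom.app V)) (hF : I.annihilatedFunctors F) :
    I.annihilatedFunctors G := by
  rw [annihilatedFunctors_iff] at hF ⊢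
  intro X Y f hf y
  obtain ⟨x, rfl⟩ := hφ X y
  rw [← FpFunctor.naturality_apply, hF f hf, map_zero]

lemma annihilatedFunctors_of_iso {F G : FpFunctor C} (e : F ≅ G) (hG : I.annihilatedFunctors G) :
    I.annihilatedFunctors F := by
  refine I.annihilatedFunctors_of_injective e.hom (fun V => ?_) hG
  refine Function.LeftInverse.injective (g := e.inv.hom.app V) fun x => ?_
  change (e.hom ≫ e.inv).hom.app V x = x
  rw [e.hom_inv_id]; rfl

/-- `coker Hom(f, -)` vanishes on an ideal if and only if all morphisms of the ideal starting in
the source of `f` factor through `f`. -/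
lemma annihilatedFunctors_fpCoker_iff {X Y : C} {f : X ⟶ Y} :
    I.annihilatedFunctors (fpCoker f) ↔ I.IsLeftFactoring f := by
  rw [annihilatedFunctors_iff]
  constructor
  · intro h V φ hφ
    have := h φ hφ (fpCoker.mk f X (𝟙 X))
    rwa [fpCoker.map_mk, Category.id_comp, fpCoker.mk_eq_zero_iff] at this
  · intro h V W φ hφ x
    obtain ⟨s, rfl⟩ := fpCoker.mk_surjective f V x
    rw [fpCoker.map_mk, fpCoker.mk_eq_zero_iff]
    exact h _ (I.comp_left_mem s hφ)

lemma isFpIdempotent_iff [HasZeroObject C] [HasBinaryBiproducts C] :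
    I.IsFpIdempotent ↔ I.annihilatedFunctors.IsClosedUnderExtensions := by
  refine ⟨fun h => h.isClosedUnderExtensions, fun h => ⟨?_, ?_, ?_, h⟩⟩
  · open ZeroObject in
    refine ⟨fpCoker (𝟙 (0 : C)), FpFunctor.isZero_fpCoker_id _, ?_⟩
    rw [annihilatedFunctors_fpCoker_iff]
    exact fun V φ _ => ⟨φ, (Category.id_comp φ).symm⟩
  · exact ⟨fun φ _ => I.annihilatedFunctors_of_injective φ
      (FpFunctor.app_injective_of_mono φ)⟩
  · exact ⟨fun φ _ => I.annihilatedFunctors_of_surjective φ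
      (FpFunctor.app_surjective_of_epi φ)⟩

variable {I}

/-- The functor of `a ≫ b` is an extension of that of `a` by that of `l = (b, cokernel.π a)`. The
latter vanishes on `I` since `b` factors through `l`. -/
lemma IsFpIdempotent.isLeftFactoring_comp [HasZeroObject C] [HasBinaryBiproducts C]
    [HasCokernels C] (hI : I.IsFpIdempotent) {X M N : C} {a : X ⟶ M} {b : M ⟶ N}
    (ha : I.IsLeftFactoring a) (hb : I.IsLeftFactoring b) : I.IsLeftFactoring (a ≫ b) := by
  let l : M ⟶ N ⊞ cokernel a := biprod.lift b (cokernel.π a)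
  let i : fpCoker l ⟶ fpCoker (a ≫ b) := fpCoker.desc _ (fpCoker.mk (a ≫ b) M a) (by
    rw [fpCoker.map_mk, fpCoker.mk_eq_zero_iff]
    exact ⟨biprod.inl, by simp [l, biprod.lift_eq]⟩)
  have hi : ∀ (V : C) (h : M ⟶ V),
      i.hom.app V (fpCoker.mk l V h) = fpCoker.mk (a ≫ b) V (a ≫ h) := fun V h => by
    rw [fpCoker.desc_mk, fpCoker.map_mk]
  let p : fpCoker (a ≫ b) ⟶ fpCoker a := fpCoker.desc _ (fpCoker.mk a X (𝟙 X)) (by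
    rw [fpCoker.map_mk, fpCoker.mk_eq_zero_iff]
    exact ⟨b, by simp⟩)
  have hp : ∀ (V : C) (h : X ⟶ V),
      p.hom.app V (fpCoker.mk (a ≫ b) V h) = fpCoker.mk a V h := fun V h => by
    rw [fpCoker.desc_mk, fpCoker.map_mk, Category.id_comp]
  have hip : i ≫ p = 0 := fpCoker.hom_ext (by
    change p.hom.app M (i.hom.app M (fpCoker.mk l M (𝟙 M))) = 0
    rw [hi, hp, fpCoker.mk_eq_zero_iff]
    exact ⟨_, rfl⟩)
  have hS : (ShortComplex.mk i p hip).ShortExact := by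
    refine FpFunctor.shortExact_of_app (fun V => ?_) (fun V y => ?_) fun V x hx => ?_
    · refine (injective_iff_map_eq_zero ((i.hom.app V).hom)).2 fun x hx => ?_
      obtain ⟨h, rfl⟩ := fpCoker.mk_surjective l V x
      obtain ⟨g, hg⟩ := (fpCoker.mk_eq_zero_iff _ _).1 ((hi V h).symm.trans hx)
      rw [fpCoker.mk_eq_zero_iff]
      -- If `a ≫ h = a ≫ b ≫ g`, then `h - b ≫ g` kills `a`; this is why `cokernel.π a` is a
      -- component of `l`.
      refine ⟨biprod.desc g (cokernel.desc a (h - b ≫ g) ?_), ?_⟩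
      · rw [Preadditive.comp_sub, hg, Category.assoc, sub_self]
      · simp [l]
    · obtain ⟨h, rfl⟩ := fpCoker.mk_surjective a V y
      exact ⟨_, hp V h⟩
    · obtain ⟨h, rfl⟩ := fpCoker.mk_surjective (a ≫ b) V x
      obtain ⟨g, rfl⟩ := (fpCoker.mk_eq_zero_iff _ _).1 ((hp V h).symm.trans hx)
      exact ⟨_, hi V g⟩
  rw [← annihilatedFunctors_fpCoker_iff]
  refine (I.isFpIdempotent_iff.1 hI).prop_X₂_of_shortExact hS ?_
    (I.annihilatedFunctors_fpCoker_iff.2 ha)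
  refine I.annihilatedFunctors_fpCoker_iff.2 fun V φ hφ => ?_
  obtain ⟨g, rfl⟩ := hb φ hφ
  exact ⟨biprod.desc g 0, by simp [l]⟩

/-- If powers of `J` annihilate both ends of a short exact sequence, then their product annihilates
the middle term. -/
lemma annihilatedFunctors_pow_add [HasZeroObject C] [HasBinaryBiproducts C] {J : HomIdeal C}
    {m n : ℕ} {S : ShortComplex (FpFunctor C)} (hS : S.ShortExact)
    (h₁ : (J ^ m).annihilatedFunctors S.X₁) (h₃ : (J ^ n).annihilatedFunctors S.X₃) :
    (J ^ (m + n)).annihilatedFunctors S.X₂ := by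
  rw [annihilatedFunctors_iff] at *
  intro X Y f hf x
  replace hf := J.pow_add_le m n _ _ hf
  induction hf using AddSubgroup.closure_induction with
  | mem h hh =>
    obtain ⟨Z, a, b, ha, hb, rfl⟩ := hh
    -- The first factor `a` kills `S.X₃`, so it moves `x` into the image of `S.X₁`, where `b` acts
    -- as zero.
    obtain ⟨y, hy⟩ := FpFunctor.exists_of_exact hS.exact (S.X₂.obj.map a x) (by
      rw [FpFunctor.naturality_apply, h₃ a ha])
    rw [FpFunctor.map_comp_apply, ← hy, ← FpFunctor.naturality_apply, h₁ b hb, map_zero]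
  | zero => exact S.X₂.map_zero_apply x
  | add a b _ _ ha hb => rw [FpFunctor.map_add_apply, ha, hb, add_zero]
  | neg a _ ha =>
    rw [S.X₂.obj.map_neg]
    exact (congr_arg Neg.neg ha).trans neg_zero

end HomIdeal

end Annihilated

/-! ### The theorem for linear categories with a dualizing module. -/

section Dualizing

/-- `E` is a dualizing module for the `k`-linear category `C` if the functionals with values in
`E` separate the submodules of all `Hom(X, Y)`, and if all the functors `Hom_k(Hom(X, -), E)` and
`Hom_k(Hom(-, Y), E)` are finitely presented. -/
structure IsDualizingModule (k : Type*) [CommRing k] (E : Type*) [AddCommGroup E] [Module k E]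
    (C : Type u) [Category.{v} C] [Preadditive C] [Linear k C] : Prop where
  exists_functional {X Y : C} (U : Submodule k (X ⟶ Y)) {f : X ⟶ Y} (hf : f ∉ U) :
    ∃ μ : (X ⟶ Y) →ₗ[k] E, (∀ g ∈ U, μ g = 0) ∧ μ f ≠ 0
  exists_presentation (X : C) : ∃ (N N' : C) (ν : (X ⟶ N) →ₗ[k] E) (p : N' ⟶ N),
    (∀ (W : C) (μ : (X ⟶ W) →ₗ[k] E), ∃ θ : W ⟶ N, ∀ h, μ h = ν (h ≫ θ)) ∧
    ∀ (W : C) (θ : W ⟶ N), (∀ h : X ⟶ W, ν (h ≫ θ) = 0) ↔ ∃ t : W ⟶ N', θ = t ≫ p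
  exists_copresentation (Y : C) : ∃ (N N' : C) (ν : (N ⟶ Y) →ₗ[k] E) (p : N ⟶ N'),
    (∀ (W : C) (μ : (W ⟶ Y) →ₗ[k] E), ∃ θ : N ⟶ W, ∀ h, μ h = ν (θ ≫ h)) ∧
    ∀ (W : C) (θ : N ⟶ W), (∀ h : W ⟶ Y, ν (θ ≫ h) = 0) ↔ ∃ t : N' ⟶ W, θ = p ≫ t

variable {C : Type u} [Category.{v} C]

/-- Images of `Hom(a, -)` and `Hom(b, -)` in `Hom(V, -)` intersect in the image given by the pushout
of `a` and `b`. -/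
lemma exists_factoring_of_finset [HasPushouts C] {V : C} {ι : Type*} (s : Finset ι)
    (P : ι → ∀ ⦃W : C⦄, (V ⟶ W) → Prop)
    (hP : ∀ i, ∃ (M : C) (a : V ⟶ M), ∀ ⦃W : C⦄ (h : V ⟶ W), P i h ↔ ∃ g, h = a ≫ g) :
    ∃ (M : C) (a : V ⟶ M), ∀ ⦃W : C⦄ (h : V ⟶ W), (∀ i ∈ s, P i h) ↔ ∃ g, h = a ≫ g := by
  classical
  induction s using Finset.induction_on with
  | empty => exact ⟨V, 𝟙 V, fun W h => ⟨fun _ => ⟨h, by simp⟩, fun _ => by simp⟩⟩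
  | insert i s _ ih =>
    obtain ⟨M, a, ha⟩ := ih
    obtain ⟨N, b, hb⟩ := hP i
    refine ⟨pushout a b, a ≫ pushout.inl a b, fun W h => ?_⟩
    rw [Finset.forall_mem_insert, ha, hb]
    constructor
    · rintro ⟨⟨g, rfl⟩, g', hg'⟩
      exact ⟨pushout.desc g' g hg'.symm, by rw [Category.assoc, pushout.inl_desc, hg']⟩
    · rintro ⟨g, rfl⟩
      exact ⟨⟨pushout.inr a b ≫ g, by rw [pushout.condition, Category.assoc]⟩,
        pushout.inl a b ≫ g, by simp⟩

lemma exists_cofactoring_of_finset [HasPullbacks C] {V : C} {ι : Type*} (s : Finset ι)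
    (P : ι → ∀ ⦃W : C⦄, (W ⟶ V) → Prop)
    (hP : ∀ i, ∃ (M : C) (a : M ⟶ V), ∀ ⦃W : C⦄ (h : W ⟶ V), P i h ↔ ∃ g, h = g ≫ a) :
    ∃ (M : C) (a : M ⟶ V), ∀ ⦃W : C⦄ (h : W ⟶ V), (∀ i ∈ s, P i h) ↔ ∃ g, h = g ≫ a := by
  classical
  induction s using Finset.induction_on with
  | empty => exact ⟨V, 𝟙 V, fun W h => ⟨fun _ => ⟨h, by simp⟩, fun _ => by simp⟩⟩
  | insert i s _ ih =>
    obtain ⟨M, a, ha⟩ := ih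
    obtain ⟨N, b, hb⟩ := hP i
    refine ⟨pullback a b, pullback.fst a b ≫ a, fun W h => ?_⟩
    rw [Finset.forall_mem_insert, ha, hb]
    constructor
    · rintro ⟨⟨g, rfl⟩, g', hg'⟩
      exact ⟨pullback.lift g' g hg'.symm, by rw [← Category.assoc, pullback.lift_fst, hg']⟩
    · rintro ⟨g, rfl⟩
      exact ⟨⟨g ≫ pullback.snd a b, by rw [pullback.condition, Category.assoc]⟩,
        g ≫ pullback.fst a b, by simp⟩

variable [Preadditive C]

namespace HomIdeal

/-- The ideal of all morphisms which are annihilated by the functor `coker Hom(f, -)`. -/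
def factorIdeal {X Y : C} (f : X ⟶ Y) : HomIdeal C where
  hom V W :=
    { carrier := {h | ∀ u : X ⟶ V, ∃ s : Y ⟶ W, u ≫ h = f ≫ s}
      zero_mem' := fun u => ⟨0, by simp⟩
      add_mem' := fun {a b} ha hb u => by
        obtain ⟨s, hs⟩ := ha u
        obtain ⟨t, ht⟩ := hb u
        exact ⟨s + t, by simp [hs, ht]⟩
      neg_mem' := fun {a} ha u => by
        obtain ⟨s, hs⟩ := ha u
        exact ⟨-s, by simp [hs]⟩ }
  comp_mem {_ _ _ _} α _ β hf u := by
    obtain ⟨s, hs⟩ := hf (u ≫ α)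
    exact ⟨s ≫ β, by rw [← Category.assoc f, ← hs]; simp⟩

lemma mem_factorIdeal {X Y : C} {f : X ⟶ Y} {V W : C} {h : V ⟶ W} :
    h ∈ (factorIdeal f).hom V W ↔ ∀ u : X ⟶ V, ∃ s : Y ⟶ W, u ≫ h = f ≫ s := Iff.rfl

lemma IsLeftFactoring.le_factorIdeal {I : HomIdeal C} {X Y : C} {f : X ⟶ Y}
    (hf : I.IsLeftFactoring f) : I ≤ factorIdeal f :=
  fun _ _ _ hh u => hf _ (I.comp_left_mem u hh)

lemma IsLeftFactoring.mono {I J : HomIdeal C} (h : I ≤ J) {X Y : C} {f : X ⟶ Y}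
    (hf : J.IsLeftFactoring f) : I.IsLeftFactoring f :=
  fun _ φ hφ => hf φ (h _ _ hφ)

lemma IsLeftFactoring.biprodMap [HasBinaryBiproducts C] {I : HomIdeal C} {X Y X' Y' : C}
    {f : X ⟶ Y} {f' : X' ⟶ Y'} (hf : I.IsLeftFactoring f) (hf' : I.IsLeftFactoring f') :
    I.IsLeftFactoring (biprod.map f f') := by
  intro V φ hφ
  obtain ⟨g, hg⟩ := hf _ (I.comp_left_mem biprod.inl hφ)
  obtain ⟨g', hg'⟩ := hf' _ (I.comp_left_mem biprod.inr hφ)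
  exact ⟨biprod.desc g g', by ext <;> simp [hg, hg']⟩

lemma factorIdeal_biprodMap_le_left [HasBinaryBiproducts C] {X Y X' Y' : C}
    (f : X ⟶ Y) (f' : X' ⟶ Y') : factorIdeal (biprod.map f f') ≤ factorIdeal f := by
  intro V W h hh u
  obtain ⟨s, hs⟩ := hh (biprod.desc u 0)
  exact ⟨biprod.inl ≫ s, by simpa using congr(biprod.inl ≫ $hs)⟩

lemma factorIdeal_biprodMap_le_right [HasBinaryBiproducts C] {X Y X' Y' : C}
    (f : X ⟶ Y) (f' : X' ⟶ Y') : factorIdeal (biprod.map f f') ≤ factorIdeal f' := by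
  intro V W h hh u
  obtain ⟨s, hs⟩ := hh (biprod.desc 0 u)
  exact ⟨biprod.inr ≫ s, by simpa using congr(biprod.inr ≫ $hs)⟩

variable {k : Type w} [CommRing k] [Linear k C]

/-- Membership is linear in the test morphism `u : X ⟶ V`, so finitely many generators `u` suffice;
each condition means factoring through the pushout of `f` along `u`. -/
lemma isCovariantlyFinite_factorIdeal (k : Type w) [CommRing k] [Linear k C] [HasPushouts C]
    [∀ X Y : C, IsNoetherian k (X ⟶ Y)] {X Y : C} (f : X ⟶ Y) :
    (factorIdeal f).IsCovariantlyFinite := by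
  intro V
  obtain ⟨s, hs⟩ := (inferInstance : Module.Finite k (X ⟶ V)).fg_top
  obtain ⟨M, a, ha⟩ := exists_factoring_of_finset s
    (fun u W (h : V ⟶ W) => ∃ t : Y ⟶ W, u ≫ h = f ≫ t) fun u =>
      ⟨pushout u f, pushout.inl u f, fun W h =>
        ⟨fun ⟨t, ht⟩ => ⟨pushout.desc h t ht, (pushout.inl_desc _ _ _).symm⟩, by
        rintro ⟨g, rfl⟩
        exact ⟨pushout.inr u f ≫ g, by rw [← Category.assoc, pushout.condition, Category.assoc]⟩⟩⟩
  have key : ∀ ⦃W : C⦄ (h : V ⟶ W), h ∈ (factorIdeal f).hom V W ↔ ∃ g, h = a ≫ g := by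
    intro W h
    rw [← ha, mem_factorIdeal]
    refine ⟨fun H u _ => H u, fun H u => ?_⟩
    have hu : u ∈ Submodule.span k (s : Set (X ⟶ V)) := hs ▸ Submodule.mem_top
    induction hu using Submodule.span_induction with
    | mem u hu => exact H u hu
    | zero => exact ⟨0, by simp⟩
    | add u v _ _ hu hv =>
      obtain ⟨s, hs⟩ := hu
      obtain ⟨t, ht⟩ := hv
      exact ⟨s + t, by simp [hs, ht]⟩
    | smul c u _ hu =>
      obtain ⟨s, hs⟩ := hu
      exact ⟨c • s, by simp [hs]⟩
  exact ⟨M, a, (key a).2 ⟨𝟙 _, by simp⟩, fun W h hh => (key h).1 hh⟩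

end HomIdeal

namespace IsDualizingModule

variable {k : Type w} [CommRing k] [Linear k C] {E : Type*} [AddCommGroup E] [Module k E]

/-- A morphism `ψ : V ⟶ N` represents `μ`, and `θ` satisfies the condition when `θ ≫ ψ` factors
through the relation `p`, that is, when `θ` factors through the pullback. -/
lemma exists_cofactoring (hE : IsDualizingModule k E C) [HasPullbacks C] {X V : C}
    (μ : (X ⟶ V) →ₗ[k] E) : ∃ (Z : C) (q : Z ⟶ V), ∀ ⦃W : C⦄ (θ : W ⟶ V),
      (∀ h : X ⟶ W, μ (h ≫ θ) = 0) ↔ ∃ t : W ⟶ Z, θ = t ≫ q := by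
  obtain ⟨N, N', ν, p, h₁, h₂⟩ := hE.exists_presentation X
  obtain ⟨ψ, hψ⟩ := h₁ V μ
  refine ⟨pullback ψ p, pullback.fst ψ p, fun W θ => ?_⟩
  simp only [hψ, Category.assoc, h₂]
  constructor
  · rintro ⟨t, ht⟩
    exact ⟨pullback.lift θ t ht, (pullback.lift_fst _ _ _).symm⟩
  · rintro ⟨t, rfl⟩
    exact ⟨t ≫ pullback.snd ψ p, by rw [Category.assoc, pullback.condition, Category.assoc]⟩

lemma exists_factoring (hE : IsDualizingModule k E C) [HasPushouts C] {X V : C}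
    (μ : (X ⟶ V) →ₗ[k] E) : ∃ (Z : C) (q : X ⟶ Z), ∀ ⦃W : C⦄ (θ : X ⟶ W),
      (∀ h : W ⟶ V, μ (θ ≫ h) = 0) ↔ ∃ t : Z ⟶ W, θ = q ≫ t := by
  obtain ⟨N, N', ν, p, h₁, h₂⟩ := hE.exists_copresentation V
  obtain ⟨ψ, hψ⟩ := h₁ X μ
  refine ⟨pushout ψ p, pushout.inl ψ p, fun W θ => ?_⟩
  simp only [hψ, ← Category.assoc, h₂]
  constructor
  · rintro ⟨t, ht⟩
    exact ⟨pushout.desc θ t ht, (pushout.inl_desc _ _ _).symm⟩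
  · rintro ⟨t, rfl⟩
    exact ⟨pushout.inr ψ p ≫ t, by rw [← Category.assoc, pushout.condition, Category.assoc]⟩

/-- Every morphism is determined by an object. -/
lemma exists_determining_functional (hE : IsDualizingModule k E C) [HasPullbacks C] {X Y : C}
    (f : X ⟶ Y) : ∃ (Z : C) (μ : (X ⟶ Z) →ₗ[k] E), ∀ ⦃W : C⦄ (g : X ⟶ W),
      (∃ s : Y ⟶ W, g = f ≫ s) ↔ ∀ t : W ⟶ Z, μ (g ≫ t) = 0 := by
  obtain ⟨N, -, ν, -, h, -⟩ := hE.exists_presentation X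
  -- `Hom(-, Z)` covers the dual of `coker Hom(f, -)`, viewed as the functionals on `Hom(X, -)` that
  -- vanish on the image of `Hom(f, -)`.
  obtain ⟨Z, q, hq⟩ := hE.exists_cofactoring (ν ∘ₗ Linear.leftComp k N f)
  simp only [LinearMap.comp_apply, Linear.leftComp_apply] at hq
  refine ⟨Z, ν ∘ₗ Linear.rightComp k X q, fun W g => ?_⟩
  simp only [LinearMap.comp_apply, Linear.rightComp_apply]
  constructor
  · rintro ⟨s, rfl⟩ t
    simpa using (hq q).2 ⟨𝟙 Z, by simp⟩ (s ≫ t)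
  · intro H
    by_contra hg
    obtain ⟨μ, hμ, hμg⟩ := hE.exists_functional (LinearMap.range (Linear.leftComp k W f)) (f := g)
      (by rintro ⟨s, rfl⟩; exact hg ⟨s, rfl⟩)
    obtain ⟨θ, hθ⟩ := h W μ
    obtain ⟨t, rfl⟩ := (hq θ).1 fun s => by
      have := hμ (f ≫ s) ⟨s, rfl⟩
      rwa [hθ, Category.assoc] at this
    refine hμg ?_
    rw [hθ, ← Category.assoc]
    exact H t

/-- The determining functional turns membership of `h` into the vanishing of all `μ (u ≫ h ≫ t)`.
This is linear in `t`, so pullbacks for finitely many `t` suffice. -/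
lemma isContravariantlyFinite_factorIdeal (hE : IsDualizingModule k E C) [HasPullbacks C]
    [∀ X Y : C, IsNoetherian k (X ⟶ Y)] {X Y : C} (f : X ⟶ Y) :
    (HomIdeal.factorIdeal f).IsContravariantlyFinite := by
  intro V
  obtain ⟨Z, μ, hμ⟩ := hE.exists_determining_functional f
  obtain ⟨s, hs⟩ := (inferInstance : Module.Finite k (V ⟶ Z)).fg_top
  obtain ⟨M, a, ha⟩ := exists_cofactoring_of_finset s
    (fun t W (h : W ⟶ V) => ∀ u : X ⟶ W, μ (u ≫ h ≫ t) = 0) fun t => by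
      obtain ⟨M, a, ha⟩ := hE.exists_cofactoring (μ ∘ₗ Linear.rightComp k X t)
      refine ⟨M, a, fun W h => ?_⟩
      rw [← ha]
      simp
  have key : ∀ ⦃W : C⦄ (h : W ⟶ V), h ∈ (HomIdeal.factorIdeal f).hom W V ↔ ∃ g, h = g ≫ a := by
    intro W h
    rw [← ha, HomIdeal.mem_factorIdeal]
    simp only [hμ, Category.assoc]
    refine ⟨fun H t _ u => H u t, fun H u t => ?_⟩
    have ht : t ∈ Submodule.span k (s : Set (V ⟶ Z)) := hs ▸ Submodule.mem_top
    induction ht using Submodule.span_induction with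
    | mem t ht => exact H t ht u
    | zero => simp
    | add t t' _ _ h h' => simp [h, h']
    | smul c t _ h => simp [h]
  exact ⟨M, a, (key a).2 ⟨𝟙 _, by simp⟩, fun W h hh => (key h).1 hh⟩

end IsDualizingModule

namespace HomIdeal

variable {k : Type w} [CommRing k] [Linear k C] {E : Type*} [AddCommGroup E] [Module k E]

/-- If the intersection of a directed collection of ideals annihilates a finitely presented
functor, then already one of them does. -/
lemma exists_isLeftFactoring_of_sInf (hE : IsDualizingModule k E C) [HasPullbacks C]
    [∀ X Y : C, IsArtinian k (X ⟶ Y)] {𝒦 : Set (HomIdeal C)} (hne : 𝒦.Nonempty)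
    (hdir : DirectedOn (· ≥ ·) 𝒦) {X Y : C} {f : X ⟶ Y} (hf : (sInf 𝒦).IsLeftFactoring f) :
    ∃ K ∈ 𝒦, K.IsLeftFactoring f := by
  obtain ⟨Z, μ, hμ⟩ := hE.exists_determining_functional f
  obtain ⟨_, ⟨K, hK, rfl⟩, hmin⟩ := IsArtinian.set_has_minimal
    ((fun K : HomIdeal C => K.homSubmodule k X Z) '' 𝒦) (hne.image _)
  refine ⟨K, hK, fun V φ hφ => ?_⟩
  rw [hμ]
  intro t
  -- Minimality and directedness force `K` to agree with the whole intersection on `Hom(X, Z)`.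
  have hmem : φ ≫ t ∈ (sInf 𝒦).hom X Z := by
    rw [mem_sInf]
    intro J hJ
    obtain ⟨L, hL, hLK, hLJ⟩ := hdir K hK J hJ
    have hle : L.homSubmodule k X Z ≤ K.homSubmodule k X Z := fun _ h => hLK _ _ h
    have hge := not_lt_iff_le_imp_ge.1 (hmin _ ⟨L, hL, rfl⟩) hle
    exact hLJ _ _ (hge (K.comp_right_mem hφ t))
  simpa using (hμ _).1 (hf _ hmem) (𝟙 Z)

lemma isFpIdempotent_of_directedOn (hE : IsDualizingModule k E C) [HasZeroObject C]
    [HasBinaryBiproducts C] [HasPullbacks C] [∀ X Y : C, IsArtinian k (X ⟶ Y)]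
    {𝒥 : Set (HomIdeal C)} (hne : 𝒥.Nonempty) (hdir : DirectedOn (· ≥ ·) (omegaPow '' 𝒥)) :
    (sInf (omegaPow '' 𝒥)).IsFpIdempotent := by
  rw [isFpIdempotent_iff]
  refine ⟨fun {S} hS h₁ h₃ => ?_⟩
  have exists_omegaPow : ∀ F : FpFunctor C, (sInf (omegaPow '' 𝒥)).annihilatedFunctors F →
      ∃ J ∈ 𝒥, J.omegaPow.annihilatedFunctors F := by
    intro F hF
    obtain ⟨X, Y, f, ⟨e⟩⟩ := F.exists_iso
    have hf := (annihilatedFunctors_fpCoker_iff _).1 (annihilatedFunctors_of_iso _ e.symm hF)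
    obtain ⟨_, ⟨J, hJ, rfl⟩, hJf⟩ := exists_isLeftFactoring_of_sInf hE (hne.image _) hdir hf
    exact ⟨J, hJ, annihilatedFunctors_of_iso _ e ((annihilatedFunctors_fpCoker_iff _).2 hJf)⟩
  have exists_pow : ∀ (F : FpFunctor C) (J : HomIdeal C), J.omegaPow.annihilatedFunctors F →
      ∃ n, (J ^ n).annihilatedFunctors F := by
    intro F J hF
    obtain ⟨X, Y, f, ⟨e⟩⟩ := F.exists_iso
    have hf := (annihilatedFunctors_fpCoker_iff _).1 (annihilatedFunctors_of_iso _ e.symm hF)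
    have hdir' : Directed (· ≥ ·) fun n : ℕ => J ^ (n + 1) :=
      Antitone.directed_ge fun m n h => J.pow_antitone (Nat.succ_le_succ h)
    obtain ⟨_, ⟨n, rfl⟩, hn⟩ := exists_isLeftFactoring_of_sInf hE (Set.range_nonempty _)
      (directedOn_range.2 hdir') hf
    exact ⟨n + 1, annihilatedFunctors_of_iso _ e ((annihilatedFunctors_fpCoker_iff _).2 hn)⟩
  obtain ⟨J₁, hJ₁, h₁⟩ := exists_omegaPow _ h₁
  obtain ⟨J₃, hJ₃, h₃⟩ := exists_omegaPow _ h₃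
  obtain ⟨_, ⟨J, hJ, rfl⟩, hJJ₁, hJJ₃⟩ := hdir _ ⟨J₁, hJ₁, rfl⟩ _ ⟨J₃, hJ₃, rfl⟩
  obtain ⟨m, hm⟩ := exists_pow S.X₁ J fun X Y f hf => h₁ f (hJJ₁ _ _ hf)
  obtain ⟨n, hn⟩ := exists_pow S.X₃ J fun X Y f hf => h₃ f (hJJ₃ _ _ hf)
  have h₂ := annihilatedFunctors_pow_add hS hm hn
  intro X Y f hf
  -- Passing through the exponent `m + n + 1` covers the case `m + n = 0`, since `J ^ ω` only
  -- involves positive powers.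
  refine h₂ f (J.pow_antitone (Nat.le_succ _) _ _ (J.omegaPow_le_pow (m + n) _ _ ?_))
  exact mem_sInf.1 hf _ ⟨J, hJ, rfl⟩

/-- A composite of `n` successive left `J`-approximations lies in `J ^ n` and is still left
`I`-factoring, so all of `I` factors through such composites. -/
lemma IsFpIdempotent.le_omegaPow {I : HomIdeal C} (hI : I.IsFpIdempotent) [HasZeroObject C]
    [HasBinaryBiproducts C] [HasCokernels C] {J : HomIdeal C} (hJ : J.IsCovariantlyFinite)
    (hIJ : I ≤ J) : I ≤ J.omegaPow := by
  have key : ∀ (n : ℕ) (V : C), ∃ (M : C) (a : V ⟶ M), a ∈ (J ^ n).hom V M ∧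
      I.IsLeftFactoring a := by
    intro n
    induction n with
    | zero => exact fun V => ⟨V, 𝟙 V, AddSubgroup.mem_top _, fun W φ _ => ⟨φ, by simp⟩⟩
    | succ n ih =>
      intro V
      obtain ⟨M, a, ha, ha'⟩ := hJ V
      obtain ⟨N, b, hb, hb'⟩ := ih M
      exact ⟨N, a ≫ b, comp_mem_pow_succ ha hb, hI.isLeftFactoring_comp (ha'.mono hIJ) hb'⟩
  intro V W φ hφ
  rw [mem_omegaPow]
  intro n
  obtain ⟨M, a, ha, ha'⟩ := key (n + 1) V
  obtain ⟨g, rfl⟩ := ha' φ hφ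
  exact comp_right_mem _ ha g

/-- For a functional `μ` separating `g` from `I`, the morphisms `θ` with all `μ (θ ≫ h)` zero are
those factoring through one `f`; they include `I` but not `g`. -/
lemma exists_isLeftFactoring_of_notMem (hE : IsDualizingModule k E C) [HasPushouts C]
    {I : HomIdeal C} {X V : C} {g : X ⟶ V} (hg : g ∉ I.hom X V) :
    ∃ (Y : C) (f : X ⟶ Y), I.IsLeftFactoring f ∧ ¬ ∃ s, g = f ≫ s := by
  obtain ⟨μ, hμ, hμg⟩ := hE.exists_functional (I.homSubmodule k X V) (f := g) hg
  obtain ⟨Y, f, hf⟩ := hE.exists_factoring μ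
  refine ⟨Y, f, fun W φ hφ => (hf φ).1 fun t => hμ _ (I.comp_right_mem hφ t), fun h => hμg ?_⟩
  simpa using (hf g).2 h (𝟙 V)

lemma IsFpIdempotent.exists_directedOn (hE : IsDualizingModule k E C) [HasZeroObject C]
    [HasBinaryBiproducts C] [HasCokernels C] [HasPushouts C] [HasPullbacks C]
    [∀ X Y : C, IsNoetherian k (X ⟶ Y)] {I : HomIdeal C} (hI : I.IsFpIdempotent) :
    ∃ 𝒥 : Set (HomIdeal C), 𝒥.Nonempty ∧ (∀ J ∈ 𝒥, J.IsCovariantlyFinite) ∧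
      (∀ J ∈ 𝒥, J.IsContravariantlyFinite) ∧ DirectedOn (· ≥ ·) 𝒥 ∧
        I = sInf (omegaPow '' 𝒥) := by
  refine ⟨{J | ∃ (X Y : C) (f : X ⟶ Y), I.IsLeftFactoring f ∧ J = factorIdeal f}, ?_, ?_, ?_, ?_,
    le_antisymm ?_ ?_⟩
  · open ZeroObject in
    exact ⟨_, 0, 0, 𝟙 0, fun V φ _ => ⟨φ, (Category.id_comp φ).symm⟩, rfl⟩
  · rintro _ ⟨X, Y, f, -, rfl⟩
    exact isCovariantlyFinite_factorIdeal k f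
  · rintro _ ⟨X, Y, f, -, rfl⟩
    exact hE.isContravariantlyFinite_factorIdeal f
  · rintro _ ⟨X, Y, f, hf, rfl⟩ _ ⟨X', Y', f', hf', rfl⟩
    exact ⟨_, ⟨_, _, _, hf.biprodMap hf', rfl⟩, factorIdeal_biprodMap_le_left f f',
      factorIdeal_biprodMap_le_right f f'⟩
  · intro X Y φ hφ
    rw [mem_sInf]
    rintro _ ⟨_, ⟨X, Y, f, hf, rfl⟩, rfl⟩
    exact hI.le_omegaPow (isCovariantlyFinite_factorIdeal k f) hf.le_factorIdeal _ _ hφ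
  · intro X Y φ hφ
    by_contra hφI
    obtain ⟨Z, f, hf, hfφ⟩ := exists_isLeftFactoring_of_notMem hE hφI
    -- Testing membership in `factorIdeal f` on the identity says that `φ` itself factors through
    -- `f`.
    have h := omegaPow_le _ _ _ (mem_sInf.1 hφ _ ⟨_, ⟨_, _, f, hf, rfl⟩, rfl⟩) (𝟙 X)
    exact hfφ (by simpa using h)

/-- The characterization of the fp-idempotent ideals of a linear category with finite length
morphism modules which admits a dualizing module. -/
theorem isFpIdempotent_iff_exists_directedOn (hE : IsDualizingModule k E C) [HasZeroObject C]
    [HasBinaryBiproducts C] [HasCokernels C] [HasPushouts C] [HasPullbacks C]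
    [∀ X Y : C, IsNoetherian k (X ⟶ Y)] [∀ X Y : C, IsArtinian k (X ⟶ Y)] (I : HomIdeal C) :
    (I.IsFpIdempotent ↔
      ∃ 𝒥 : Set (HomIdeal C), 𝒥.Nonempty ∧
        DirectedOn (· ≥ ·) (HomIdeal.omegaPow '' 𝒥) ∧ I = sInf (HomIdeal.omegaPow '' 𝒥)) ∧
    (I.IsFpIdempotent ↔
      ∃ 𝒥 : Set (HomIdeal C), 𝒥.Nonempty ∧
        (∀ J ∈ 𝒥, J.IsCovariantlyFinite) ∧
        DirectedOn (· ≥ ·) 𝒥 ∧ I = sInf (HomIdeal.omegaPow '' 𝒥)) ∧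
    (I.IsFpIdempotent ↔
      ∃ 𝒥 : Set (HomIdeal C), 𝒥.Nonempty ∧
        (∀ J ∈ 𝒥, J.IsContravariantlyFinite) ∧
        DirectedOn (· ≥ ·) 𝒥 ∧ I = sInf (HomIdeal.omegaPow '' 𝒥)) := by
  have hdir : ∀ {𝒥 : Set (HomIdeal C)}, DirectedOn (· ≥ ·) 𝒥 →
      DirectedOn (· ≥ ·) (omegaPow '' 𝒥) := by
    rintro 𝒥 h _ ⟨J, hJ, rfl⟩ _ ⟨J', hJ', rfl⟩
    obtain ⟨L, hL, h₁, h₂⟩ := h J hJ J' hJ'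
    exact ⟨_, ⟨L, hL, rfl⟩, omegaPow_mono h₁, omegaPow_mono h₂⟩
  refine ⟨⟨fun hI => ?_, ?_⟩, ⟨fun hI => ?_, ?_⟩, ⟨fun hI => ?_, ?_⟩⟩
  · obtain ⟨𝒥, hne, -, -, h, h'⟩ := hI.exists_directedOn hE
    exact ⟨𝒥, hne, hdir h, h'⟩
  · rintro ⟨𝒥, hne, h, rfl⟩
    exact isFpIdempotent_of_directedOn hE hne h
  · obtain ⟨𝒥, hne, h₁, -, h, h'⟩ := hI.exists_directedOn hE
    exact ⟨𝒥, hne, h₁, h, h'⟩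
  · rintro ⟨𝒥, hne, -, h, rfl⟩
    exact isFpIdempotent_of_directedOn hE hne (hdir h)
  · obtain ⟨𝒥, hne, -, h₁, h, h'⟩ := hI.exists_directedOn hE
    exact ⟨𝒥, hne, h₁, h, h'⟩
  · rintro ⟨𝒥, hne, -, h, rfl⟩
    exact isFpIdempotent_of_directedOn hE hne (hdir h)

end HomIdeal

end Dualizing

/-! ### Injective hulls inside an injective module. -/

section InjectiveHull

variable {R : Type u} [Ring R] {Q : Type v} [AddCommGroup Q] [Module R Q]

lemma Submodule.exists_maximal_disjoint {N K : Submodule R Q} (h : Disjoint K N) :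
    ∃ L, K ≤ L ∧ Maximal (Disjoint · N) L := by
  refine zorn_le_nonempty₀ {L : Submodule R Q | Disjoint L N} (fun c hc hc' y hy => ?_) K h
  refine ⟨sSup c, ?_, fun z hz => le_sSup hz⟩
  exact (hc'.directedOn.disjoint_sSup_left).2 fun L hL => hc hL

/-- Inside an injective module, every submodule has an essential extension which is injective. -/
lemma Module.Injective.exists_essential_extension [Small.{v} R] [Module.Injective R Q]
    (S : Submodule R Q) : ∃ E : Submodule R Q, S ≤ E ∧ Module.Injective R E ∧
      ∀ N ≤ E, Disjoint N S → N = ⊥ := by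
  obtain ⟨K, -, hK⟩ := Submodule.exists_maximal_disjoint (disjoint_bot_left (a := S))
  obtain ⟨E, hSE, hE⟩ := Submodule.exists_maximal_disjoint hK.prop.symm
  have hEK : Disjoint E K := hE.prop
  have hK' : ∀ L, K ≤ L → Disjoint L E → L ≤ K := fun L hL hLE =>
    hK.le_of_ge (hLE.mono_right hSE) hL
  refine ⟨E, hSE, ?_, fun N hN hNS => ?_⟩
  · have hinj : Function.Injective (K.mkQ ∘ₗ E.subtype) := by
      rw [← LinearMap.ker_eq_bot, LinearMap.ker_comp, Submodule.ker_mkQ, eq_bot_iff]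
      intro x hx
      exact Subtype.ext (Submodule.disjoint_def.1 hEK x x.2 hx)
    -- The inclusion of `E` extends to `Q ⧸ K`. Maximality will force the range of the extension
    -- back into `E`, which makes `E` a retract of `Q`.
    obtain ⟨φ, hφ⟩ := Module.Injective.extension_property R Q _ _ _ hinj E.subtype
    have hφE : ∀ x ∈ E, φ (K.mkQ x) = x := fun x hx => DFunLike.congr_fun hφ ⟨x, hx⟩
    have hle : E ≤ LinearMap.range φ := fun x hx => ⟨_, hφE x hx⟩
    have hdisj : Disjoint (LinearMap.range φ) K := by
      have h1 : K.comap (φ ∘ₗ K.mkQ) ≤ K := by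
        refine hK' _ (fun x hx => ?_) ?_
        · have : K.mkQ x = 0 := by simpa using hx
          simp [this]
        · rw [Submodule.disjoint_def]
          intro x hx hxE
          refine Submodule.disjoint_def.1 hEK x hxE ?_
          have : φ (K.mkQ x) ∈ K := hx
          rwa [hφE x hxE] at this
      rw [Submodule.disjoint_def]
      rintro _ ⟨y, rfl⟩ hy
      obtain ⟨x, rfl⟩ := K.mkQ_surjective y
      have : K.mkQ x = 0 := by simpa using h1 hy
      rw [this, map_zero]
    have hge : LinearMap.range φ ≤ E := hE.le_of_ge hdisj hle
    let r : Q →ₗ[R] E := (φ ∘ₗ K.mkQ).codRestrict E fun x => hge ⟨_, rfl⟩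
    refine ⟨fun X Y _ _ _ _ f hf g => ?_⟩
    obtain ⟨h, hh⟩ := Module.Injective.extension_property R Q _ _ f hf (E.subtype ∘ₗ g)
    refine ⟨r ∘ₗ h, fun x => Subtype.ext ?_⟩
    have : h (f x) = g x := DFunLike.congr_fun hh x
    change φ (K.mkQ (h (f x))) = g x
    rw [this, hφE _ (g x).2]
  · have h1 : Disjoint K (N ⊔ S) := hEK.symm.mono_right (sup_le hN hSE)
    have h2 : Disjoint (K ⊔ N) S := hNS.disjoint_sup_left_of_disjoint_sup_right h1
    have h3 : N ≤ K := le_sup_right.trans (hK.le_of_ge h2 le_sup_left)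
    exact eq_bot_iff.2 (hEK hN h3)

end InjectiveHull

/-! ### Matlis duality over a commutative artinian ring. -/

section Matlis

/-- A module which gives rise to a duality on the modules of finite length: it is an injective
cogenerator of finite length, and all modules of finite length are reflexive with respect to it. -/
structure IsMatlisModule (k : Type u) [CommRing k] (E : Type u) [AddCommGroup E] [Module k E] :
    Prop where
  injective : Module.Injective k E
  isFiniteLength : IsFiniteLength k E
  exists_ne_zero {M : Type u} [AddCommGroup M] [Module k M] {x : M} (hx : x ≠ 0) :
    ∃ φ : M →ₗ[k] E, φ x ≠ 0
  exists_eval {M : Type u} [AddCommGroup M] [Module k M] (hM : IsFiniteLength k M)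
    (Φ : (M →ₗ[k] E) →ₗ[k] E) : ∃ x : M, ∀ φ, Φ φ = φ x

variable {k : Type u} [CommRing k]

/-- Some element of `m` lies outside `n` and hence acts invertibly on the field `k ⧸ n`. -/
lemma eq_zero_of_smul_eq_zero_of_ne {m : MaximalSpectrum k}
    {t : ∀ m : MaximalSpectrum k, k ⧸ m.asIdeal} (ht : ∀ a ∈ m.asIdeal, a • t = 0)
    {n : MaximalSpectrum k} (hn : n ≠ m) : t n = 0 := by
  have hle : ¬ m.asIdeal ≤ n.asIdeal := fun h =>
    hn (MaximalSpectrum.ext (m.isMaximal.eq_of_le n.isMaximal.ne_top h).symm)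
  obtain ⟨a, ham, han⟩ := Set.not_subset.1 hle
  have := n.isMaximal
  let := Ideal.Quotient.field n.asIdeal
  have h := congr_fun (ht a ham) n
  rw [Pi.smul_apply, Algebra.smul_def] at h
  exact (mul_eq_zero.1 h).resolve_left fun h' => han (Ideal.Quotient.eq_zero_iff_mem.1 h')

lemma exists_smul_eq_of_annihilated {m : MaximalSpectrum k}
    {t s : ∀ m : MaximalSpectrum k, k ⧸ m.asIdeal} (ht : ∀ a ∈ m.asIdeal, a • t = 0)
    (hs : ∀ a ∈ m.asIdeal, a • s = 0) (ht0 : t ≠ 0) : ∃ c : k, s = c • t := by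
  classical
  have := m.isMaximal
  let := Ideal.Quotient.field m.asIdeal
  have htm : t m ≠ 0 := fun h => ht0 (by
    ext n
    by_cases hn : n = m
    · subst hn; exact h
    · exact eq_zero_of_smul_eq_zero_of_ne ht hn)
  obtain ⟨c, hc⟩ := Ideal.Quotient.mk_surjective (s m / t m)
  refine ⟨c, ?_⟩
  ext n
  by_cases hn : n = m
  · subst hn
    rw [Pi.smul_apply, Algebra.smul_def]
    change _ = Ideal.Quotient.mk _ c * _
    rw [hc, div_mul_cancel₀ _ htm]
  · rw [Pi.smul_apply, eq_zero_of_smul_eq_zero_of_ne ht hn, eq_zero_of_smul_eq_zero_of_ne hs hn,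
      smul_zero]

variable {E : Type u} [AddCommGroup E] [Module k E]

/-- By essentiality, a nonzero map from a simple module lands in the product of residue fields. The
image of a generator is killed by its maximal ideal `m`, so it lies in the one-dimensional factor `k
⧸ m`. -/
lemma exists_eq_smul_of_essential (i : (∀ m : MaximalSpectrum k, k ⧸ m.asIdeal) →ₗ[k] E)
    (hi : Function.Injective i)
    (hess : ∀ N : Submodule k E, Disjoint N (LinearMap.range i) → N = ⊥)
    {L : Type u} [AddCommGroup L] [Module k L] [IsSimpleModule k L] {φ : L →ₗ[k] E} (hφ : φ ≠ 0)
    (ψ : L →ₗ[k] E) : ∃ c : k, ψ = c • φ := by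
  by_cases hψ : ψ = 0
  · exact ⟨0, by simp [hψ]⟩
  have hrange : ∀ χ : L →ₗ[k] E, χ ≠ 0 → ∀ x, ∃ t, i t = χ x := by
    intro χ hχ x
    have h1 : ¬ Disjoint (LinearMap.range χ) (LinearMap.range i) := fun h =>
      hχ (LinearMap.range_eq_bot.1 (hess _ h))
    have h2 : (LinearMap.range i).comap χ = ⊤ := by
      refine (eq_bot_or_eq_top _).resolve_left fun h => h1 ?_
      rw [Submodule.disjoint_def]
      rintro _ ⟨y, rfl⟩ hy
      have : y ∈ (LinearMap.range i).comap χ := hy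
      rw [h, Submodule.mem_bot] at this
      rw [this, map_zero]
    have h3 : x ∈ (LinearMap.range i).comap χ := h2 ▸ Submodule.mem_top
    exact h3
  have := IsSimpleModule.nontrivial k L
  obtain ⟨x, hx⟩ := exists_ne (0 : L)
  let m : MaximalSpectrum k :=
    ⟨LinearMap.ker (LinearMap.toSpanSingleton k L x),
      IsSimpleModule.ker_toSpanSingleton_isMaximal k hx⟩
  obtain ⟨t, ht⟩ := hrange φ hφ x
  obtain ⟨s, hs⟩ := hrange ψ hψ x
  have key : ∀ (χ : L →ₗ[k] E) r, i r = χ x → ∀ a ∈ m.asIdeal, a • r = 0 := by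
    intro χ r hr a ha
    have ha' : a • x = 0 := ha
    apply hi
    rw [map_smul, hr, ← map_smul, ha', map_zero, map_zero]
  have ht0 : t ≠ 0 := by
    rintro rfl
    rw [map_zero] at ht
    exact hx ((LinearMap.injective_of_ne_zero hφ) (by rw [← ht, map_zero]))
  obtain ⟨c, hc⟩ := exists_smul_eq_of_annihilated (key φ t ht) (key ψ s hs) ht0
  refine ⟨c, LinearMap.ext fun y => ?_⟩
  obtain ⟨b, rfl⟩ := IsSimpleModule.toSpanSingleton_surjective k hx y
  simp only [LinearMap.toSpanSingleton_apply, map_smul, LinearMap.smul_apply]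
  rw [← hs, ← ht, hc, map_smul]

lemma Module.length_le_one_of_forall_smul {M : Type*} [AddCommGroup M] [Module k M]
    (h : ∀ x y : M, x ≠ 0 → ∃ c : k, y = c • x) : Module.length k M ≤ 1 := by
  rcases subsingleton_or_nontrivial M with hM | hM
  · rw [Module.length_eq_zero]; exact zero_le_one
  · have : IsSimpleModule k M :=
      isSimpleModule_iff_toSpanSingleton_surjective.2 ⟨hM, fun x hx y => by
      obtain ⟨c, rfl⟩ := h x y hx
      exact ⟨c, rfl⟩⟩
    rw [Module.length_eq_one]

/-- Dualizing into an injective module is exact, so the bound for simple modules adds up along a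
composition series. -/
lemma length_linearMap_le [Module.Injective k E]
    (hsimple : ∀ (L : Type u) [AddCommGroup L] [Module k L] [IsSimpleModule k L],
      Module.length k (L →ₗ[k] E) ≤ 1)
    {M : Type u} [AddCommGroup M] [Module k M] (hM : IsFiniteLength k M) :
    Module.length k (M →ₗ[k] E) ≤ Module.length k M := by
  induction hM with
  | of_subsingleton => rw [Module.length_eq_zero]; exact zero_le
  | @of_simple_quotient M _ _ N _ _ ih =>
    have h1 := Module.length_eq_add_of_exact (LinearMap.lcomp k E N.mkQ)
      (LinearMap.lcomp k E N.subtype) ?_ ?_ ?_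
    · have h2 := Module.length_eq_add_of_exact N.subtype N.mkQ N.injective_subtype
        N.mkQ_surjective (LinearMap.exact_subtype_mkQ N)
      rw [h1, h2, add_comm, Module.length_eq_one k (M ⧸ N)]
      exact add_le_add ih (hsimple _)
    · intro a b hab
      exact LinearMap.cancel_right N.mkQ_surjective |>.1 hab
    · intro g
      exact Module.Injective.extension_property k E _ _ _ N.injective_subtype g
    · intro g
      constructor
      · intro hg
        have hgN : N ≤ LinearMap.ker g := fun x hx => DFunLike.congr_fun hg (⟨x, hx⟩ : N)
        exact ⟨N.liftQ g hgN, by ext; simp⟩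
      · rintro ⟨h, rfl⟩
        ext x
        have : N.mkQ x = 0 := by simp
        change h (N.mkQ x) = 0
        rw [this, map_zero]

/-- `E` is an injective hull of the product of all residue fields. Duals are no longer than the
original module, so `E`, being the dual of `k`, has finite length, and the injective evaluation into
the double dual is surjective. -/
theorem exists_isMatlisModule (k : Type u) [CommRing k] [IsArtinianRing k] :
    ∃ (E : Type u) (_ : AddCommGroup E) (_ : Module k E), IsMatlisModule k E := by
  classical
  let T := ∀ m : MaximalSpectrum k, k ⧸ m.asIdeal
  let Q : ModuleCat.{u} k := CategoryTheory.Injective.under (ModuleCat.of k T)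
  let j : T →ₗ[k] Q := (CategoryTheory.Injective.ι (ModuleCat.of k T)).hom
  have hj : Function.Injective j := (ModuleCat.mono_iff_injective _).1 inferInstance
  have hQ : CategoryTheory.Injective Q := CategoryTheory.Injective.injective_under _
  have : Module.Injective k Q := Module.injective_module_of_injective_object k Q (inj := hQ)
  obtain ⟨E, hjE, hE, hess⟩ := Module.Injective.exists_essential_extension (LinearMap.range j)
  let i : T →ₗ[k] E := j.codRestrict E fun t => hjE ⟨t, rfl⟩
  have hi : Function.Injective i := fun a b h => hj congr(($h : Q))
  have hess' : ∀ N : Submodule k E, Disjoint N (LinearMap.range i) → N = ⊥ := by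
    intro N hN
    have h := hess (N.map E.subtype) (Submodule.map_subtype_le E N) (by
      rw [Submodule.disjoint_def] at hN ⊢
      rintro _ ⟨x, hx, rfl⟩ ⟨t, ht⟩
      have := hN x hx ⟨t, Subtype.ext ht⟩
      rw [this, map_zero])
    exact Submodule.map_injective_of_injective E.injective_subtype
      (h.trans (Submodule.map_bot _).symm)
  have hlen : ∀ {M : Type u} [AddCommGroup M] [Module k M], IsFiniteLength k M →
      Module.length k (M →ₗ[k] E) ≤ Module.length k M := fun hM =>
    length_linearMap_le (fun L _ _ _ => Module.length_le_one_of_forall_smul fun φ ψ hφ =>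
      exists_eq_smul_of_essential i hi hess' hφ ψ) hM
  have hfin : ∀ {M : Type u} [AddCommGroup M] [Module k M], IsFiniteLength k M →
      IsFiniteLength k (M →ₗ[k] E) := fun hM =>
    Module.length_ne_top_iff.1 ((hlen hM).trans_lt
      (lt_top_iff_ne_top.2 (Module.length_ne_top_iff.2 hM))).ne
  have hcog : ∀ {M : Type u} [AddCommGroup M] [Module k M] {x : M}, x ≠ 0 →
      ∃ φ : M →ₗ[k] E, φ x ≠ 0 := by
    intro M _ _ x hx
    let τ := LinearMap.toSpanSingleton k M x
    have hτ : LinearMap.ker τ ≠ ⊤ := by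
      intro h
      have : (1 : k) ∈ LinearMap.ker τ := h ▸ Submodule.mem_top
      exact hx (by simpa [τ] using this)
    -- The submodule generated by `x` surjects onto some residue field `k ⧸ m`, which embeds in `E`;
    -- injectivity extends this map to `M`.
    obtain ⟨m, hm, hτm⟩ := Ideal.exists_le_maximal (LinearMap.ker τ) hτ
    let t : T := Pi.single ⟨m, hm⟩ 1
    have ht : t ≠ 0 := by
      have : Nontrivial (k ⧸ m) := Ideal.Quotient.nontrivial_iff.2 hm.ne_top
      intro h
      have := congr_fun h ⟨m, hm⟩
      rw [show t ⟨m, hm⟩ = 1 from Pi.single_eq_same _ _] at this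
      exact one_ne_zero (α := k ⧸ m) this
    let g : (k ⧸ LinearMap.ker τ) →ₗ[k] E :=
      (LinearMap.ker τ).liftQ (LinearMap.toSpanSingleton k E (i t)) fun a ha => by
        have : a • t = 0 := by
          have h1 : a • (1 : k ⧸ m) = 0 := by
            rw [Algebra.smul_def, mul_one]
            exact Ideal.Quotient.eq_zero_iff_mem.2 (hτm ha)
          rw [← Pi.single_smul]
          exact (congr_arg _ h1).trans (Pi.single_zero _)
        simp [← map_smul, this]
    obtain ⟨φ, hφ⟩ := Module.Injective.extension_property k E _ _
      ((LinearMap.ker τ).liftQ τ le_rfl)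
      (LinearMap.ker_eq_bot.1 (Submodule.ker_liftQ_eq_bot' _ _ rfl)) g
    refine ⟨φ, fun h0 => ht (hi ?_)⟩
    have h1 : φ (τ 1) = LinearMap.toSpanSingleton k E (i t) 1 :=
      DFunLike.congr_fun hφ ((LinearMap.ker τ).mkQ 1)
    rw [LinearMap.toSpanSingleton_apply, LinearMap.toSpanSingleton_apply, one_smul, one_smul,
      h0] at h1
    rw [← h1, map_zero]
  refine ⟨E, inferInstance, inferInstance, hE, ?_, hcog, fun {M} _ _ hM Φ => ?_⟩
  · exact (LinearMap.ringLmapEquivSelf k k E).isFiniteLength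
      (hfin (isFiniteLength_iff_isNoetherian_isArtinian.2 ⟨inferInstance, inferInstance⟩))
  · let ev : M →ₗ[k] (M →ₗ[k] E) →ₗ[k] E := LinearMap.applyₗ
    have hev : Function.Injective ev := by
      refine (injective_iff_map_eq_zero ev).2 fun x hx => by_contra fun h => ?_
      obtain ⟨φ, hφ⟩ := hcog h
      exact hφ (DFunLike.congr_fun hx φ)
    obtain ⟨_, _⟩ := isFiniteLength_iff_isNoetherian_isArtinian.1 (hfin (hfin hM))
    have htop : LinearMap.range ev = ⊤ := by
      by_contra h
      have h1 := Submodule.length_lt h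
      rw [← (LinearEquiv.ofInjective ev hev).length_eq] at h1
      exact absurd ((hlen (hfin hM)).trans (hlen hM)) h1.not_ge
    obtain ⟨x, rfl⟩ := LinearMap.range_eq_top.1 htop Φ
    exact ⟨x, fun φ => rfl⟩

end Matlis

/-! ### The abelian category of finite length modules. -/

section FinLength

variable (A : Type u) [Ring A]

/-- The modules of finite length, as a property of objects of the category of modules. -/
abbrev isFiniteLengthModule : ObjectProperty (ModuleCat.{u} A) :=
  fun M => IsFiniteLength A M

instance : (isFiniteLengthModule A).IsClosedUnderSubobjects where
  prop_of_mono f _ hY := IsFiniteLength.of_injective hY ((ModuleCat.mono_iff_injective f).1 ‹_›)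

instance : (isFiniteLengthModule A).IsClosedUnderQuotients where
  prop_of_epi f _ hX := IsFiniteLength.of_surjective hX ((ModuleCat.epi_iff_surjective f).1 ‹_›)

instance : (isFiniteLengthModule A).ContainsZero where
  exists_zero := ⟨ModuleCat.of A PUnit, ModuleCat.isZero_of_subsingleton _,
    IsFiniteLength.of_subsingleton⟩

lemma IsFiniteLength.pi {ι : Type*} [Finite ι] {M : ι → Type*} [∀ i, AddCommGroup (M i)]
    [∀ i, Module A (M i)] (h : ∀ i, IsFiniteLength A (M i)) : IsFiniteLength A (∀ i, M i) := by
  have h1 : ∀ i, IsNoetherian A (M i) := fun i =>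
    (isFiniteLength_iff_isNoetherian_isArtinian.1 (h i)).1
  have h2 : ∀ i, IsArtinian A (M i) := fun i =>
    (isFiniteLength_iff_isNoetherian_isArtinian.1 (h i)).2
  exact isFiniteLength_iff_isNoetherian_isArtinian.2 ⟨inferInstance, inferInstance⟩

instance : (isFiniteLengthModule A).IsClosedUnderFiniteProducts where
  isClosedUnderLimitsOfShape J _ := by
    constructor
    rintro X ⟨p⟩
    refine IsFiniteLength.of_injective (f := LinearMap.pi fun j : J => (p.π.app ⟨j⟩).hom)
      (IsFiniteLength.pi A fun j => p.prop_diag_obj ⟨j⟩) ?_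
    refine (injective_iff_map_eq_zero _).2 fun x hx => ?_
    have h : ModuleCat.ofHom (LinearMap.toSpanSingleton A X x) = 0 := by
      refine p.isLimit.hom_ext fun ⟨j⟩ => ?_
      ext
      simpa using congr_fun hx j
    simpa using congr($h (1 : A))

instance : Abelian (FinLengthModuleCat A) :=
  inferInstanceAs (Abelian (isFiniteLengthModule A).FullSubcategory)

end FinLength

/-! ### Coinduced modules and their adjunction. -/

section Coinduced

variable (k : Type u) [CommRing k] (A : Type u) [Ring A] [Algebra k A]
  (E : Type u) [AddCommGroup E] [Module k E]

/-- The `A`-module `Hom_k(A, E)`. -/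
def Coind : Type u := A →ₗ[k] E

namespace Coind

instance : AddCommGroup (Coind k A E) := inferInstanceAs (AddCommGroup (A →ₗ[k] E))

instance : Module k (Coind k A E) := inferInstanceAs (Module k (A →ₗ[k] E))

instance : FunLike (Coind k A E) A E := inferInstanceAs (FunLike (A →ₗ[k] E) A E)

instance : LinearMapClass (Coind k A E) k A E := inferInstanceAs (LinearMapClass (A →ₗ[k] E) k A E)

variable {k A E}

@[ext]
lemma ext {φ ψ : Coind k A E} (h : ∀ a, φ a = ψ a) : φ = ψ := DFunLike.ext _ _ h

@[simp] lemma add_apply (φ ψ : Coind k A E) (a : A) : (φ + ψ) a = φ a + ψ a := rfl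

@[simp] lemma zero_apply (a : A) : (0 : Coind k A E) a = 0 := rfl

@[simp] lemma smul_apply' (c : k) (φ : Coind k A E) (a : A) : (c • φ) a = c • φ a := rfl

instance : SMul A (Coind k A E) where
  smul a φ := LinearMap.comp (σ₁₂ := RingHom.id k) φ (LinearMap.mulRight k a)

@[simp] lemma smul_apply (a : A) (φ : Coind k A E) (b : A) : (a • φ) b = φ (b * a) := rfl

instance : Module A (Coind k A E) where
  one_smul φ := by ext; simp
  mul_smul a b φ := by ext; simp [mul_assoc]
  smul_zero a := by ext; simp
  smul_add a φ ψ := by ext; simp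
  add_smul a b φ := by ext; simp [mul_add]
  zero_smul φ := by ext; simp

lemma algebraMap_smul (c : k) (φ : Coind k A E) : algebraMap k A c • φ = c • φ := by
  ext a
  rw [smul_apply, smul_apply', ← Algebra.commutes, ← Algebra.smul_def, map_smul]

instance : IsScalarTower k A (Coind k A E) where
  smul_assoc c a φ := by rw [← algebraMap_smul, Algebra.smul_def, mul_smul]

/-- Evaluation at a fixed element of `A`. -/
def eval (a : A) : Coind k A E →ₗ[k] E where
  toFun φ := φ a
  map_add' _ _ := rfl
  map_smul' _ _ := rfl

@[simp] lemma eval_apply (a : A) (φ : Coind k A E) : eval a φ = φ a := rfl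

/-- The right multiplication by an element of `A` on `Hom_k(A, E)`. -/
def rightMul (a : A) : Coind k A E →ₗ[A] Coind k A E where
  toFun φ := LinearMap.comp (σ₁₂ := RingHom.id k) φ (LinearMap.mulLeft k a)
  map_add' _ _ := rfl
  map_smul' b φ := by
    ext c
    change φ (a * c * b) = φ (a * (c * b))
    rw [mul_assoc]

@[simp] lemma rightMul_apply (a : A) (φ : Coind k A E) (b : A) : rightMul a φ b = φ (a * b) := rfl

variable {W : Type*} [AddCommGroup W] [Module A W] [Module k W] [IsScalarTower k A W]

/-- The `A`-linear map to `Hom_k(A, E)` corresponding to a `k`-linear map to `E`. -/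
def lift (ψ : W →ₗ[k] E) : W →ₗ[A] Coind k A E where
  toFun w := ψ ∘ₗ (LinearMap.toSpanSingleton A W w).restrictScalars k
  map_add' v w := by ext a; exact (congr_arg ψ (smul_add a v w)).trans (map_add ψ _ _)
  map_smul' b w := by ext a; exact congr_arg ψ (smul_smul a b w)

@[simp] lemma lift_apply (ψ : W →ₗ[k] E) (w : W) (a : A) : lift ψ w a = ψ (a • w) := rfl

end Coind

end Coinduced

/-! ### Extension of functionals, generators and relations. -/

section ModuleLemmas

lemma LinearMap.exists_comp_eq_of_ker_le {k : Type u} [CommRing k] {E : Type u} [AddCommGroup E]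
    [Module k E] [Module.Injective k E] {M N : Type*} [AddCommGroup M] [Module k M]
    [AddCommGroup N] [Module k N] (R : M →ₗ[k] N) (ψ : M →ₗ[k] E)
    (h : LinearMap.ker R ≤ LinearMap.ker ψ) : ∃ χ : N →ₗ[k] E, χ ∘ₗ R = ψ := by
  obtain ⟨χ, hχ⟩ := Module.Injective.extension_property k E _ _
    ((LinearMap.ker R).liftQ R le_rfl)
    (LinearMap.ker_eq_bot.1 (Submodule.ker_liftQ_eq_bot' _ _ rfl)) ((LinearMap.ker R).liftQ ψ h)
  exact ⟨χ, LinearMap.ext fun x => DFunLike.congr_fun hχ ((LinearMap.ker R).mkQ x)⟩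

lemma LinearMap.eq_sum_single {k : Type*} [Semiring k] {ι : Type*} [Fintype ι] [DecidableEq ι]
    {M : ι → Type*} [∀ i, AddCommMonoid (M i)] [∀ i, Module k (M i)] {N : Type*} [AddCommMonoid N]
    [Module k N] (f : (∀ i, M i) →ₗ[k] N) (x : ∀ i, M i) :
    f x = ∑ i, f (LinearMap.single k M i (x i)) := by
  rw [← map_sum]
  congr 1
  exact (LinearMap.sum_single_apply M x).symm

/-- A finite presentation by generators and relations. -/
lemma Module.Finite.exists_generators_relations {A : Type u} [Ring A] [IsNoetherianRing A]
    (X : Type u) [AddCommGroup X] [Module A X] [Module.Finite A X] :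
    ∃ (n m : ℕ) (x : Fin n → X) (r : Fin m → Fin n → A), Submodule.span A (Set.range x) = ⊤ ∧
      ∀ (W : Type u) [AddCommGroup W] [Module A W] (w : Fin n → W),
        (∀ j, ∑ i, r j i • w i = 0) ↔ ∃ h : X →ₗ[A] W, ∀ i, h (x i) = w i := by
  classical
  have := Module.finitePresentation_of_finite A X
  obtain ⟨n, m, f, g, hf, hfg⟩ := Module.FinitePresentation.exists_fin' A X
  let x : Fin n → X := fun i => f (Pi.single i 1)
  let r : Fin m → Fin n → A := fun j => g (Pi.single j 1)
  have hfx : f = Fintype.linearCombination A x := by ext i; simp [x]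
  refine ⟨n, m, x, r, ?_, fun W _ _ w => ⟨fun hw => ?_, ?_⟩⟩
  · rw [← Fintype.range_linearCombination, ← hfx, LinearMap.range_eq_top.2 hf]
  · let L := Fintype.linearCombination A w
    have hLg : L ∘ₗ g = 0 := by
      ext j
      simpa [L, Fintype.linearCombination_apply] using hw j
    have hle : LinearMap.ker f ≤ LinearMap.ker L := by
      intro v hv
      obtain ⟨u, rfl⟩ := (hfg v).1 hv
      exact DFunLike.congr_fun hLg u
    refine ⟨(LinearMap.ker f).liftQ L hle ∘ₗ (f.quotKerEquivOfSurjective hf).symm, fun i => ?_⟩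
    have : (f.quotKerEquivOfSurjective hf).symm (x i) = (LinearMap.ker f).mkQ (Pi.single i 1) := by
      rw [LinearEquiv.symm_apply_eq]; rfl
    rw [LinearMap.comp_apply, LinearEquiv.coe_coe, this]
    change L (Pi.single i 1) = w i
    simp [L]
  · rintro ⟨h, hh⟩ j
    simp only [← hh, ← map_smul, ← map_sum]
    have h1 : f (g (Pi.single j 1)) = 0 := hfg.apply_apply_eq_zero _
    rw [hfx, Fintype.linearCombination_apply] at h1
    rw [h1, map_zero]

end ModuleLemmas

/-! ### Presenting the duals of `Hom(X, -)` and `Hom(-, Y)`. -/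

section Presentation

variable {k : Type u} [CommRing k] {A : Type u} [Ring A] [Algebra k A]
  {E : Type u} [AddCommGroup E] [Module k E]

/-- The map between powers of `Hom_k(A, E)` given by a matrix. -/
def Coind.matrixMap {n m : ℕ} (r : Fin m → Fin n → A) :
    (Fin m → Coind k A E) →ₗ[A] (Fin n → Coind k A E) :=
  LinearMap.pi fun i => ∑ j, Coind.rightMul (r j i) ∘ₗ LinearMap.proj j

lemma Coind.sum_apply {ι : Type*} (s : Finset ι) (φ : ι → Coind k A E) (a : A) :
    (∑ i ∈ s, φ i) a = ∑ i ∈ s, φ i a := map_sum (Coind.eval a) φ s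

lemma Coind.matrixMap_apply {n m : ℕ} (r : Fin m → Fin n → A) (q : Fin m → Coind k A E) (i : Fin n)
    (a : A) : Coind.matrixMap r q i a = ∑ j, q j (r j i * a) := by
  simp [Coind.matrixMap, Coind.sum_apply]

variable {X W : Type u} [AddCommGroup X] [Module A X] [AddCommGroup W] [Module A W]
  [Module k W] [IsScalarTower k A W]

/-- The evaluation of linear maps at a finite family of elements. -/
def LinearMap.evalFamily (k : Type u) [CommRing k] (A : Type u) [Ring A] [Algebra k A]
    [Module A X] (W : Type u) [AddCommGroup W] [Module A W] [Module k W] [IsScalarTower k A W]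
    {n : ℕ} (x : Fin n → X) : (X →ₗ[A] W) →ₗ[k] (Fin n → W) where
  toFun h i := h (x i)
  map_add' _ _ := rfl
  map_smul' _ _ := rfl

lemma LinearMap.evalFamily_injective {n : ℕ} {x : Fin n → X}
    (hx : Submodule.span A (Set.range x) = ⊤) :
    Function.Injective (LinearMap.evalFamily k A W x) := by
  intro h h' hh
  exact LinearMap.ext_on_range hx fun i => congr_fun hh i

/-- Generators embed `Hom(X, W)` into `W ^ n`. The functional extends there, and each component `W →
E` corresponds by adjunction to a map into `Coind k A E`. -/
lemma exists_coind_of_functional [Module.Injective k E] {n : ℕ} {x : Fin n → X}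
    (hx : Submodule.span A (Set.range x) = ⊤) (μ : (X →ₗ[A] W) →ₗ[k] E) :
    ∃ θ : W →ₗ[A] (Fin n → Coind k A E), ∀ h : X →ₗ[A] W, μ h = ∑ i, θ (h (x i)) i 1 := by
  obtain ⟨ψ, hψ⟩ := Module.Injective.extension_property k E _ _ _
    (LinearMap.evalFamily_injective (W := W) (k := k) hx) μ
  refine ⟨LinearMap.pi fun i => Coind.lift (ψ ∘ₗ LinearMap.single k (fun _ => W) i), fun h => ?_⟩
  rw [← hψ, LinearMap.comp_apply, LinearMap.eq_sum_single]
  simp [LinearMap.evalFamily]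

/-- The relations exhibit `Hom(X, W)` as the kernel of `W ^ n → W ^ m`. A functional on `W ^ n` that
vanishes on this kernel extends along the map to `W ^ m`. -/
lemma forall_functional_eq_zero_iff_exists_coind [Module.Injective k E] {n m : ℕ} {x : Fin n → X}
    {r : Fin m → Fin n → A}
    (hr : ∀ (W : Type u) [AddCommGroup W] [Module A W] (w : Fin n → W),
        (∀ j, ∑ i, r j i • w i = 0) ↔ ∃ h : X →ₗ[A] W, ∀ i, h (x i) = w i)
    (θ : W →ₗ[A] (Fin n → Coind k A E)) :
    (∀ h : X →ₗ[A] W, ∑ i, θ (h (x i)) i 1 = 0) ↔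
      ∃ t : W →ₗ[A] (Fin m → Coind k A E), θ = Coind.matrixMap r ∘ₗ t := by
  constructor
  · intro H
    let ψ : (Fin n → W) →ₗ[k] E := ∑ i, Coind.eval 1 ∘ₗ LinearMap.proj i ∘ₗ
      θ.restrictScalars k ∘ₗ LinearMap.proj i
    have hψ : ∀ w, ψ w = ∑ i, θ (w i) i 1 := fun w => by simp [ψ]
    let R : (Fin n → W) →ₗ[k] (Fin m → W) := LinearMap.pi fun j =>
      ∑ i, Algebra.lsmul k k W (r j i) ∘ₗ LinearMap.proj i
    have hR : ∀ w j, R w j = ∑ i, r j i • w i := fun w j => by simp [R]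
    obtain ⟨χ, hχ⟩ := LinearMap.exists_comp_eq_of_ker_le R ψ fun w hw => by
      obtain ⟨h, hh⟩ := (hr W w).1 fun j => (hR w j).symm.trans (congr_fun hw j)
      rw [LinearMap.mem_ker, hψ, ← H h]
      simp only [hh]
    refine ⟨LinearMap.pi fun j => Coind.lift (χ ∘ₗ LinearMap.single k (fun _ => W) j), ?_⟩
    ext w i a
    have h1 : ψ (Pi.single i (a • w)) = θ w i a := by
      rw [hψ, Finset.sum_eq_single i (fun b _ hb => by simp [Pi.single_eq_of_ne hb]) (by simp)]
      simp
    have h2 : R (Pi.single i (a • w)) = fun j => r j i • a • w := by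
      ext j
      rw [hR, Finset.sum_eq_single i (fun b _ hb => by simp [Pi.single_eq_of_ne hb]) (by simp)]
      simp
    rw [← h1, ← hχ, LinearMap.comp_apply, h2, LinearMap.eq_sum_single, LinearMap.comp_apply,
      Coind.matrixMap_apply]
    simp [mul_smul]
  · rintro ⟨t, rfl⟩ h
    have h0 : ∀ j, ∑ i, r j i • x i = 0 := (hr X x).2 ⟨LinearMap.id, fun _ => rfl⟩
    simp only [LinearMap.comp_apply, Coind.matrixMap_apply, mul_one]
    rw [Finset.sum_comm]
    refine Finset.sum_eq_zero fun j _ => ?_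
    have h1 : t (h (∑ i, r j i • x i)) j 1 = 0 := by rw [h0 j]; simp
    simpa [Coind.sum_apply] using h1

/-- By adjunction, `ι` embeds `Hom(W, Y)` into the `n`-th power of the dual of `W`. A functional
extended to that power is evaluation at elements of `W`, by reflexivity. -/
lemma exists_of_functional_coind (hE : IsMatlisModule k E) (hW : IsFiniteLength k W) {n : ℕ}
    {Y : Type u} [AddCommGroup Y] [Module A Y] [Module k Y] [IsScalarTower k A Y]
    {ι : Y →ₗ[A] (Fin n → Coind k A E)} (hι : Function.Injective ι) (μ : (W →ₗ[A] Y) →ₗ[k] E) :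
    ∃ w : Fin n → W, ∀ h : W →ₗ[A] Y, μ h = ∑ i, ι (h (w i)) i 1 := by
  have := hE.injective
  let δ : (W →ₗ[A] Y) →ₗ[k] (Fin n → (W →ₗ[k] E)) :=
    { toFun := fun h i => Coind.eval 1 ∘ₗ LinearMap.proj i ∘ₗ (ι ∘ₗ h).restrictScalars k
      map_add' := fun h h' => by ext; simp
      map_smul' := fun c h => by
        ext i w
        have : ι (c • h w) = c • ι (h w) := map_smul (ι.restrictScalars k) c (h w)
        simp [this] }
  have hδ' : ∀ h i w, δ h i w = ι (h w) i 1 := fun _ _ _ => rfl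
  have hδ : Function.Injective δ := by
    intro h h' hh
    ext w
    apply hι
    ext i a
    have := congr($hh i (a • w))
    rw [hδ', hδ'] at this
    simpa using this
  obtain ⟨Ψ, hΨ⟩ := Module.Injective.extension_property k E _ _ δ hδ μ
  choose w hw using fun i => hE.exists_eval hW (Ψ ∘ₗ LinearMap.single k (fun _ => W →ₗ[k] E) i)
  refine ⟨w, fun h => ?_⟩
  rw [← hΨ, LinearMap.comp_apply, LinearMap.eq_sum_single]
  exact Finset.sum_congr rfl fun i _ => hw i (δ h i)

lemma forall_functional_eq_zero_iff_exists_matrix (hE : IsMatlisModule k E)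
    (hW : IsFiniteLength k W) {n m : ℕ}
    {Y : Type u} [AddCommGroup Y] [Module A Y]
    {ι : Y →ₗ[A] (Fin n → Coind k A E)} (hι : Function.Injective ι)
    {π : (Fin n → Coind k A E) →ₗ[A] (Fin m → Coind k A E)} (hπ : Function.Exact ι π)
    {a : Fin m → Fin n → A} (ha : ∀ v j, π v j 1 = ∑ i, v i (a j i)) (w : Fin n → W) :
    (∀ h : W →ₗ[A] Y, ∑ i, ι (h (w i)) i 1 = 0) ↔
      ∃ ξ : Fin m → W, ∀ i, w i = ∑ j, a j i • ξ j := by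
  have := hE.injective
  constructor
  · intro H
    let Ψ : (Fin n → (W →ₗ[k] E)) →ₗ[k] E := ∑ i, LinearMap.applyₗ (w i) ∘ₗ LinearMap.proj i
    have hΨ : ∀ g, Ψ g = ∑ i, g i (w i) := fun g => by simp [Ψ]
    let R : (Fin n → (W →ₗ[k] E)) →ₗ[k] (Fin m → (W →ₗ[k] E)) := LinearMap.pi fun j =>
      ∑ i, LinearMap.lcomp k E (Algebra.lsmul k k W (a j i)) ∘ₗ LinearMap.proj i
    have hR : ∀ g j v, R g j v = ∑ i, g i (a j i • v) := fun g j v => by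
      simp [R, LinearMap.sum_apply]
    -- The kernel of `R` is `Hom(W, Y)`: a family `g` in it assembles to a map `G` into `ker π`,
    -- which is the image of `ι`.
    obtain ⟨χ, hχ⟩ := LinearMap.exists_comp_eq_of_ker_le R Ψ fun g hg => by
      let G : W →ₗ[A] (Fin n → Coind k A E) := LinearMap.pi fun i => Coind.lift (g i)
      have hG : ∀ v, π (G v) = 0 := fun v => by
        ext j b
        have h1 : π (G (b • v)) j 1 = π (G v) j b := by simp
        rw [← h1, ha]
        have := congr($hg j (b • v))
        rw [hR] at this
        simpa [G, mul_smul] using this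
      let e := LinearEquiv.ofInjective ι hι
      let h : W →ₗ[A] Y := e.symm ∘ₗ G.codRestrict (LinearMap.range ι) fun v => (hπ _).1 (hG v)
      have hh : ∀ v, ι (h v) = G v := fun v =>
        congr_arg Subtype.val (e.apply_symm_apply ⟨G v, (hπ _).1 (hG v)⟩)
      rw [LinearMap.mem_ker, hΨ, ← H h]
      simp [hh, G]
    choose ξ hξ using fun j => hE.exists_eval hW (χ ∘ₗ LinearMap.single k (fun _ => W →ₗ[k] E) j)
    refine ⟨ξ, fun i => ?_⟩
    by_contra hne
    obtain ⟨φ, hφ⟩ := hE.exists_ne_zero (sub_ne_zero.2 hne)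
    apply hφ
    have h1 : Ψ (Pi.single i φ) = φ (w i) := by
      rw [hΨ, Finset.sum_eq_single i (fun b _ hb => by simp [Pi.single_eq_of_ne hb]) (by simp)]
      simp
    have h2 : χ (R (Pi.single i φ)) = ∑ j, φ (a j i • ξ j) := by
      rw [LinearMap.eq_sum_single]
      refine Finset.sum_congr rfl fun j _ => (hξ j _).trans ?_
      rw [hR, Finset.sum_eq_single i (fun b _ hb => by simp [Pi.single_eq_of_ne hb]) (by simp)]
      simp
    rw [map_sub, map_sum, ← h1, ← h2, ← hχ, LinearMap.comp_apply, sub_self]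
  · rintro ⟨ξ, hξ⟩ h
    simp only [hξ, map_sum, map_smul, Finset.sum_apply, Pi.smul_apply, Coind.sum_apply,
      Coind.smul_apply, one_mul]
    rw [Finset.sum_comm]
    refine Finset.sum_eq_zero fun j _ => ?_
    rw [← ha, hπ.apply_apply_eq_zero]
    rfl

end Presentation

/-! ### Copresentations by coinduced modules. -/

section Embedding

variable {k : Type u} [CommRing k] {E : Type u} [AddCommGroup E] [Module k E]

lemma IsMatlisModule.finite_linearMap [IsNoetherianRing k] (hE : IsMatlisModule k E) {Y : Type u}
    [AddCommGroup Y] [Module k Y] [Module.Finite k Y] : Module.Finite k (Y →ₗ[k] E) := by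
  obtain ⟨n, y, hy⟩ := Module.Finite.exists_fin (R := k) (M := Y)
  have := (isFiniteLength_iff_isNoetherian_isArtinian.1 hE.isFiniteLength).1
  exact Module.Finite.of_injective _ (LinearMap.evalFamily_injective (k := k) (W := E) hy)

variable {A : Type u} [Ring A] [Algebra k A]

lemma IsMatlisModule.exists_injective_coind [IsNoetherianRing k] (hE : IsMatlisModule k E)
    (Y : Type u) [AddCommGroup Y] [Module A Y] [Module k Y] [IsScalarTower k A Y]
    [Module.Finite k Y] :
    ∃ (n : ℕ) (ι : Y →ₗ[A] (Fin n → Coind k A E)), Function.Injective ι := by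
  have := hE.finite_linearMap (Y := Y)
  obtain ⟨n, φ, hφ⟩ := Module.Finite.exists_fin (R := k) (M := Y →ₗ[k] E)
  refine ⟨n, LinearMap.pi fun i => Coind.lift (φ i), (injective_iff_map_eq_zero _).2 fun y hy => ?_⟩
  by_contra hne
  obtain ⟨ψ, hψ⟩ := hE.exists_ne_zero hne
  have h : (LinearMap.applyₗ y : (Y →ₗ[k] E) →ₗ[k] E) = 0 :=
    LinearMap.ext_on_range hφ fun i => by simpa using congr($hy i 1)
  exact hψ (DFunLike.congr_fun h ψ)

lemma IsMatlisModule.exists_copresentation_coind [IsNoetherianRing k] [IsArtinianRing k]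
    [Module.Finite k A] (hE : IsMatlisModule k E)
    (Y : Type u) [AddCommGroup Y] [Module A Y] [Module k Y] [IsScalarTower k A Y]
    [Module.Finite k Y] :
    ∃ (n m : ℕ) (ι : Y →ₗ[A] (Fin n → Coind k A E))
      (π : (Fin n → Coind k A E) →ₗ[A] (Fin m → Coind k A E)) (a : Fin m → Fin n → A),
      Function.Injective ι ∧ Function.Exact ι π ∧ ∀ v j, π v j 1 = ∑ i, v i (a j i) := by
  obtain ⟨n, ι, hι⟩ := hE.exists_injective_coind (A := A) Y
  have : Module.Finite k (Coind k A E) := hE.finite_linearMap (Y := A)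
  obtain ⟨m, ι', hι'⟩ := hE.exists_injective_coind (A := A)
    ((Fin n → Coind k A E) ⧸ LinearMap.range ι)
  let π := ι' ∘ₗ (LinearMap.range ι).mkQ
  have hA : IsFiniteLength k A :=
    isFiniteLength_iff_isNoetherian_isArtinian.2 ⟨inferInstance, inferInstance⟩
  -- Each matrix entry of `π`, evaluated at `1`, is a functional on the dual of `A`, hence
  -- evaluation at an element of `A`.
  choose a ha using fun (j : Fin m) (i : Fin n) => hE.exists_eval hA
    (Coind.eval 1 ∘ₗ LinearMap.proj j ∘ₗ π.restrictScalars k ∘ₗ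
      LinearMap.single k (fun _ => Coind k A E) i : Coind k A E →ₗ[k] E)
  refine ⟨n, m, ι, π, a, hι, fun v => ?_, fun v j => ?_⟩
  · rw [← LinearMap.mem_ker, LinearMap.ker_comp, LinearMap.ker_eq_bot.2 hι',
      ← LinearMap.ker, Submodule.ker_mkQ]
    rfl
  · change (Coind.eval 1 ∘ₗ LinearMap.proj j ∘ₗ π.restrictScalars k) v = _
    rw [LinearMap.eq_sum_single]
    exact Finset.sum_congr rfl fun i _ => ha j i (v i)

end Embedding

/-! ### The dualizing module for finite length modules. -/

namespace FinLengthModuleCat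

open ModuleCat.Algebra

variable {k : Type u} [CommRing k] {A : Type u} [Ring A] [Algebra k A]

/-- Morphisms of modules of finite length as linear maps. -/
def homLinearEquiv (k : Type u) [CommRing k] [Algebra k A] (X Y : FinLengthModuleCat A) :
    (X ⟶ Y) ≃ₗ[k] (X.obj →ₗ[A] Y.obj) where
  toFun f := f.hom.hom
  invFun f := ObjectProperty.homMk (ModuleCat.ofHom f)
  map_add' _ _ := rfl
  map_smul' _ _ := rfl
  left_inv _ := rfl
  right_inv _ := rfl

/-- The object given by a module of finite length. -/
abbrev of (M : Type u) [AddCommGroup M] [Module A M] (hM : IsFiniteLength A M) :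
    FinLengthModuleCat A := ⟨ModuleCat.of A M, hM⟩

/-- The morphism given by a linear map. -/
abbrev ofHom {X Y : FinLengthModuleCat A} (f : X.obj →ₗ[A] Y.obj) : X ⟶ Y :=
  ObjectProperty.homMk (ModuleCat.ofHom f)

variable [IsArtinianRing k] [Module.Finite k A]

lemma finite_obj (k : Type u) [CommRing k] [Algebra k A] [Module.Finite k A]
    (X : FinLengthModuleCat A) : Module.Finite k X.obj := by
  have := (isFiniteLength_iff_isNoetherian_isArtinian.1 X.property).1
  exact Module.Finite.trans A X.obj

lemma isFiniteLength_of_finite (k : Type u) [CommRing k] [Algebra k A] [IsArtinianRing k]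
    (M : Type u) [AddCommGroup M] [Module A M] [Module k M] [IsScalarTower k A M]
    [Module.Finite k M] : IsFiniteLength A M :=
  isFiniteLength_iff_isNoetherian_isArtinian.2
    ⟨isNoetherian_of_tower k inferInstance, isArtinian_of_tower k inferInstance⟩

lemma isFiniteLength_obj (k : Type u) [CommRing k] [IsArtinianRing k] [Algebra k A]
    [Module.Finite k A] (X : FinLengthModuleCat A) : IsFiniteLength k X.obj := by
  have := finite_obj k X
  exact isFiniteLength_iff_isNoetherian_isArtinian.2 ⟨inferInstance, inferInstance⟩

lemma isFiniteLength_hom (X Y : FinLengthModuleCat A) : IsFiniteLength k (X ⟶ Y) := by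
  have := (isFiniteLength_iff_isNoetherian_isArtinian.1 X.property).1
  obtain ⟨n, x, hx⟩ := Module.Finite.exists_fin (R := A) (M := X.obj)
  refine IsFiniteLength.of_injective
    (f := LinearMap.evalFamily k A Y.obj x ∘ₗ (homLinearEquiv k X Y).toLinearMap)
    (IsFiniteLength.pi k fun _ => isFiniteLength_obj k Y) ?_
  exact (LinearMap.evalFamily_injective (k := k) (W := Y.obj) hx).comp
    (homLinearEquiv k X Y).injective

variable {E : Type u} [AddCommGroup E] [Module k E]

theorem isDualizingModule (hE : IsMatlisModule k E) :
    IsDualizingModule k E (FinLengthModuleCat A) where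
  exists_functional {X Y} U f hf := by
    have hne : U.mkQ f ≠ 0 := by simpa using hf
    obtain ⟨φ, hφ⟩ := hE.exists_ne_zero hne
    exact ⟨φ ∘ₗ U.mkQ, fun g hg => by
      have : U.mkQ g = 0 := by simpa using hg
      rw [LinearMap.comp_apply, this, map_zero], hφ⟩
  exists_presentation X := by
    have := hE.injective
    have := (isFiniteLength_iff_isNoetherian_isArtinian.1 X.property).1
    have : IsNoetherianRing A := isNoetherian_of_tower k inferInstance
    have : Module.Finite k (Coind k A E) := hE.finite_linearMap (Y := A)
    obtain ⟨n, m, x, r, hx, hr⟩ := Module.Finite.exists_generators_relations (A := A) X.obj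
    let N := of (Fin n → Coind k A E) (isFiniteLength_of_finite (A := A) k _)
    let N' := of (Fin m → Coind k A E) (isFiniteLength_of_finite (A := A) k _)
    let ν : (X ⟶ N) →ₗ[k] E :=
      { toFun := fun h => ∑ i, (h.hom.hom (x i) : Fin n → Coind k A E) i 1
        map_add' := fun h h' => by
          rw [← Finset.sum_add_distrib]; rfl
        map_smul' := fun c h => by
          rw [RingHom.id_apply, Finset.smul_sum]
          refine Finset.sum_congr rfl fun i _ => ?_
          exact congr($(Coind.algebraMap_smul c
            ((h.hom.hom (x i) : Fin n → Coind k A E) i)) (1 : A)) }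
    refine ⟨N, N', ν, ofHom (Coind.matrixMap r), fun W μ => ?_, fun W θ => ?_⟩
    · obtain ⟨θ, hθ⟩ := exists_coind_of_functional hx
        (μ ∘ₗ (homLinearEquiv k X W).symm.toLinearMap)
      exact ⟨ofHom (Y := N) θ, fun h => hθ h.hom.hom⟩
    · have h := forall_functional_eq_zero_iff_exists_coind (k := k) (E := E) (W := W.obj) hr
        θ.hom.hom
      refine ⟨fun H => ?_, ?_⟩
      · obtain ⟨t, ht⟩ := h.1 fun f => H (ofHom f)
        exact ⟨ofHom (Y := N') t, by ext : 2; exact ht⟩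
      · rintro ⟨t, rfl⟩ f
        exact h.2 ⟨t.hom.hom, rfl⟩ f.hom.hom
  exists_copresentation Y := by
    have := finite_obj k Y
    obtain ⟨n, m, ι, π, a, hι, hπ, ha⟩ := hE.exists_copresentation_coind (A := A) Y.obj
    let N := of (Fin n → A) (isFiniteLength_of_finite (A := A) k _)
    let N' := of (Fin m → A) (isFiniteLength_of_finite (A := A) k _)
    let e : Fin n → (Fin n → A) := fun i => Pi.single i 1
    let ν : (N ⟶ Y) →ₗ[k] E :=
      { toFun := fun h => ∑ i, ι (h.hom.hom (e i)) i 1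
        map_add' := fun h h' => by
          rw [← Finset.sum_add_distrib]
          exact Finset.sum_congr rfl fun i _ =>
            congr($(map_add ι (h.hom.hom (e i)) (h'.hom.hom (e i))) i (1 : A))
        map_smul' := fun c h => by
          rw [RingHom.id_apply, Finset.smul_sum]
          exact Finset.sum_congr rfl fun i _ =>
            congr($(map_smul (ι.restrictScalars k) c (h.hom.hom (e i))) i (1 : A)) }
    let p : (Fin n → A) →ₗ[A] (Fin m → A) := Fintype.linearCombination A fun i j => a j i
    refine ⟨N, N', ν, ofHom p, fun W μ => ?_, fun W θ => ?_⟩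
    · obtain ⟨w, hw⟩ := exists_of_functional_coind hE (isFiniteLength_obj k W) hι
        (μ ∘ₗ (homLinearEquiv k W Y).symm.toLinearMap)
      refine ⟨ofHom (X := N) (Fintype.linearCombination A w), fun h => (hw h.hom.hom).trans ?_⟩
      refine Finset.sum_congr rfl fun i _ => ?_
      have : Fintype.linearCombination A w (e i) = w i := by simp [e]
      exact congr(ι (h.hom.hom $(this.symm)) i (1 : A))
    · have h := forall_functional_eq_zero_iff_exists_matrix hE (isFiniteLength_obj k W) hι hπ ha
        fun i => θ.hom.hom (e i)
      have key : (∃ ξ : Fin m → W.obj, ∀ i, θ.hom.hom (e i) = ∑ j, a j i • ξ j) ↔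
          ∃ t : N' ⟶ W, θ = ofHom p ≫ t := by
        constructor
        · rintro ⟨ξ, hξ⟩
          refine ⟨ofHom (X := N') (Fintype.linearCombination A ξ), ?_⟩
          ext : 2
          refine LinearMap.pi_ext' fun i => LinearMap.ext_ring ((hξ i).trans ?_)
          change _ = Fintype.linearCombination A ξ (p (e i))
          simp [p, e, Fintype.linearCombination_apply]
        · rintro ⟨t, rfl⟩
          refine ⟨fun j => t.hom.hom (Pi.single j 1), fun i => ?_⟩
          change t.hom.hom (p (e i)) = _
          have : p (e i) = ∑ j, a j i • (Pi.single j 1 : Fin m → A) := by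
            ext l
            simp [p, e, Finset.sum_apply, Pi.single_apply]
          rw [this, map_sum]
          simp
      rw [← key, ← h]
      exact ⟨fun H f => H (ofHom f), fun H f => H f.hom.hom⟩

end FinLengthModuleCat

/-! ### Change of base ring and conclusion. -/

section Main

/-- An Artin algebra over some commutative artinian ring is an Artin algebra over a commutative
artinian ring which lives in the same universe. -/
lemma exists_artinian_base {k : Type v} {A : Type u} [CommRing k] [IsArtinianRing k] [Ring A]
    [Algebra k A] [Module.Finite k A] : ∃ (l : Type u) (_ : CommRing l) (_ : Algebra l A),
      IsArtinianRing l ∧ Module.Finite l A := by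
  let f : k →+* Subring.center A := (algebraMap k A).codRestrict (Subring.center A) fun c =>
    Subring.mem_center_iff.2 fun a => (Algebra.commutes c a).symm
  let : Algebra k f.range := f.rangeRestrict.toAlgebra
  have : IsScalarTower k f.range A := IsScalarTower.of_algebraMap_eq fun _ => rfl
  exact ⟨f.range, inferInstance, inferInstance, f.rangeRestrict_surjective.isArtinianRing,
    Module.Finite.of_restrictScalars_finite k f.range A⟩

end Main

end

theorem theorem5p9 {k : Type*} {A : Type*} [CommRing k] [IsArtinianRing k] [Ring A]
    [Algebra k A] [Module.Finite k A] (I : HomIdeal (FinLengthModuleCat A)) :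
    (I.IsFpIdempotent ↔
      ∃ 𝒥 : Set (HomIdeal (FinLengthModuleCat A)), 𝒥.Nonempty ∧
        DirectedOn (· ≥ ·) (HomIdeal.omegaPow '' 𝒥) ∧ I = sInf (HomIdeal.omegaPow '' 𝒥)) ∧
    (I.IsFpIdempotent ↔
      ∃ 𝒥 : Set (HomIdeal (FinLengthModuleCat A)), 𝒥.Nonempty ∧
        (∀ J ∈ 𝒥, J.IsCovariantlyFinite) ∧
        DirectedOn (· ≥ ·) 𝒥 ∧ I = sInf (HomIdeal.omegaPow '' 𝒥)) ∧
    (I.IsFpIdempotent ↔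
      ∃ 𝒥 : Set (HomIdeal (FinLengthModuleCat A)), 𝒥.Nonempty ∧
        (∀ J ∈ 𝒥, J.IsContravariantlyFinite) ∧
        DirectedOn (· ≥ ·) 𝒥 ∧ I = sInf (HomIdeal.omegaPow '' 𝒥)) := by
  -- The statement to prove does not mention the base ring, so it may be replaced by one in the
  -- universe of `A`, where Matlis duality applies.
  obtain ⟨l, _, _, _, _⟩ := exists_artinian_base (k := k) (A := A)
  obtain ⟨E, _, _, hE⟩ := exists_isMatlisModule l
  let : Linear l (ModuleCat A) := ModuleCat.Algebra.instLinear
  have hfin (X Y : FinLengthModuleCat A) := isFiniteLength_iff_isNoetherian_isArtinian.1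
    (FinLengthModuleCat.isFiniteLength_hom (k := l) X Y)
  have (X Y : FinLengthModuleCat A) : IsNoetherian l (X ⟶ Y) := (hfin X Y).1
  have (X Y : FinLengthModuleCat A) : IsArtinian l (X ⟶ Y) := (hfin X Y).2
  exact HomIdeal.isFpIdempotent_iff_exists_directedOn
    (FinLengthModuleCat.isDualizingModule (A := A) hE) I
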